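/- Let $\beta,\lambda>0$, $\nu\in(0,1]$, let $N\ge 1$ be an integer, and put $\rho=\lambda/\beta^{\nu}$. Consider the following network. Webpages appear as a homogeneous Yule process of rate $\beta$ started from one page at time $0$ (while $k$ pages are present, the next page appears after an independent exponential time of rate $\beta k$). The numbers of in-links of the pages, counted from the creation of each page, are independent fractional nonlinear birth processes, independent of the creation times, with birth rates $\lambda_r=\lambda r(N-r)$ for $1\le r\le N$ (states above $N$ are never reached; set $\lambda_r=0$ for $r>N$): each is a counting process started from $1$ whose state probabilities $p_n(t)$ are locally absolutely continuous on $[0,\infty)$ and satisfy $$\frac{d^\nu p_n}{dt^\nu}(t)=-\lambda_n p_n(t)+\lambda_{n-1}p_{n-1}(t)\quad(n\ge1,\ t>0),\qquad p_0=0,\quad p_n(0)=\delta_{n,1},$$ where $\frac{d^\nu f}{dt^\nu}(t)=\frac1{\Gamma(1-\nu)}\int_0^t (t-s)^{-\nu}f'(s)\,ds$ is the Caputo derivative for $\nu\in(0,1)$ and the ordinary derivative for $\nu=1$. Let $S_t$ be the number of in-links at time $t$ of a webpage chosen uniformly at random among those present at time $t$. Write $b=\frac12\sqrt{N^2+4/\rho}$.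 Then $\lim_{t\to\infty}\mathbb P(S_t=n)=q_n$ for $1\le n\le N$, where $$q_n=\rho^{-1}\,\frac{\Gamma(n)\Gamma(N)}{\Gamma(N-n+1)}\,\frac{\Gamma(b+1-\frac N2)}{\Gamma(b+1-\frac N2+n)}\,\frac{\Gamma(b+\frac N2-n)}{\Gamma(b+\frac N2)},$$ and $\sum_{n=1}^N q_n=1$. Moreover, if $1-\frac N2-b$ is not a nonpositive integer, the limit also equals $$\frac{(-1)^n}{\rho}\,\frac{\Gamma(n)\Gamma(N)}{\Gamma(N-n+1)}\,\frac{\Gamma(1-\frac N2-b)}{\Gamma(n+1-\frac N2-b)}\,\frac{\Gamma(1-\frac N2+b)}{\Gamma(n+1-\frac N2+b)},$$ and for every $\rho$ as above, including the exceptional ones, this expression, taken at $r$ in place of $\rho$ (also in $b$), tends to $q_n$ as $r\to\rho$, $r\ne\rho$. Finally, if $\rho=\frac1{N+1}$, then $q_n=\left(1+\frac1N\right)\frac1{n^2+n}$ for $1\le n\le N$, so that this is the limit of $\mathbb P(S_t=n)$. -/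

import Mathlib

open MeasureTheory ProbabilityTheory Filter Topology
open scoped NNReal

namespace YuleNetwork

noncomputable section

variable {Ω : Type*}

/-- Caputo derivative of order `ν ∈ (0, 1]` with base point `0`. For `ν ∈ (0, 1)` it is
`(1 / Γ (1 - ν)) ∫₀ᵗ f' s / (t - s) ^ ν ds`; for `ν = 1` it is the ordinary derivative. -/
def caputoDeriv (ν : ℝ) (f : ℝ → ℝ) (t : ℝ) : ℝ :=
  if ν = 1 then deriv f t
  else (1 / Real.Gamma (1 - ν)) * ∫ s in (0 : ℝ)..t, deriv f s / (t - s) ^ ν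

/-- State probability `p_n(t) = P(Y(t) = n)` of an integer-valued process. -/
def stateProb [MeasurableSpace Ω] (μ : Measure Ω) (Y : ℝ≥0 → Ω → ℕ) (n : ℕ) (t : ℝ) : ℝ :=
  μ.real {ω | Y t.toNNReal ω = n}

/-- `Y` is a fractional nonlinear birth process with fractionality parameter `ν` and birth rates
`rate 1, rate 2, …`, started from one individual: a counting process (right-continuous,
nondecreasing, unit jumps, no explosion since the values are natural numbers) whose state
probabilities solve the fractional difference-differential system
`d^ν p_n / dt^ν = - rate n * p_n + rate (n - 1) * p_{n-1}` for `n ≥ 1`, with `p_0 = 0` and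
`p_n(0) = δ_{n,1}` (the last two follow from `start` and `mono`). The equation of index `n + 1`
is written for `n ≥ 0`. -/
structure IsFractionalBirthProcess [MeasurableSpace Ω] (μ : Measure Ω) (ν : ℝ) (rate : ℕ → ℝ)
    (Y : ℝ≥0 → Ω → ℕ) : Prop where
  measurable : ∀ t, Measurable (Y t)
  start : ∀ ω, Y 0 ω = 1
  mono : ∀ ω, Monotone fun t => Y t ω
  rightCont : ∀ ω t, ContinuousWithinAt (fun s => Y s ω) (Set.Ici t) t
  unitJump : ∀ ω t, 0 < t → ∀ᶠ s in 𝓝[<] t, Y t ω ≤ Y s ω + 1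
  absCont : ∀ n : ℕ, ∀ T : ℝ, 0 ≤ T → AbsolutelyContinuousOnInterval (stateProb μ Y n) 0 T
  equation : ∀ n : ℕ, ∀ t : ℝ, 0 < t →
    caputoDeriv ν (stateProb μ Y (n + 1)) t
      = -rate (n + 1) * stateProb μ Y (n + 1) t + rate n * stateProb μ Y n t

/-- Creation time of page `k`, where page `0` is the initial page, created at time `0`, and
`gap i` is the time between the creations of pages `i` and `i + 1`. -/
def birthTime (gap : ℕ → Ω → ℝ) (k : ℕ) (ω : Ω) : ℝ :=
  ∑ i ∈ Finset.range k, gap i ω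

/-- Number of webpages present at time `t`. -/
def pageCount (gap : ℕ → Ω → ℝ) (t : ℝ) (ω : Ω) : ℕ :=
  {k : ℕ | birthTime gap k ω ≤ t}.ncard

/-- The `σ`-algebra generated by the whole network: creation times and in-link processes. -/
abbrev networkSigma (gap : ℕ → Ω → ℝ) (X : ℕ → ℝ≥0 → Ω → ℕ) : MeasurableSpace Ω :=
  MeasurableSpace.comap
    (fun ω => ((fun i => gap i ω, fun i s => X i s ω) : (ℕ → ℝ) × (ℕ → ℝ≥0 → ℕ)))
    inferInstance

/-- The generalized nonlinear Yule model.
* Webpages develop as a homogeneous Yule process of rate `β` started from one page: while `i + 1`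
  pages are present the waiting time `gap i` for the next page is exponential of rate
  `β * (i + 1)`, and the waiting times are independent.
* Each page `i` carries a fractional nonlinear birth process `X i` (run from the creation of the
  page) that counts its in-links; these are independent of each other and of the creation times.
* `pick t` is a page chosen uniformly at random at time `t`: given the network it is uniformly
  distributed on the pages present at time `t`. -/
structure IsGeneralizedYuleModel [MeasurableSpace Ω] (μ : Measure Ω) (β ν : ℝ) (rate : ℕ → ℝ)
    (gap : ℕ → Ω → ℝ) (X : ℕ → ℝ≥0 → Ω → ℕ) (pick : ℝ → Ω → ℕ) : Prop where
  gap_measurable : ∀ i, Measurable (gap i)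
  gap_law : ∀ i : ℕ, μ.map (gap i) = expMeasure (β * (i + 1))
  gap_indep : iIndepFun gap μ
  inlinks : ∀ i, IsFractionalBirthProcess μ ν rate (X i)
  inlinks_indep : iIndepFun (fun i ω => fun s : ℝ≥0 => X i s ω) μ
  gap_inlinks_indep : IndepFun (fun ω => fun i => gap i ω) (fun ω => fun i s => X i s ω) μ
  pick_measurable : ∀ t, Measurable (pick t)
  pick_uniform : ∀ t : ℝ, 0 ≤ t → ∀ k : ℕ, ∀ A : Set Ω, MeasurableSet[networkSigma gap X] A →
    μ.real (A ∩ {ω | pick t ω = k})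
      = ∫ ω in A, (if birthTime gap k ω ≤ t then ((pageCount gap t ω : ℝ))⁻¹ else 0) ∂μ

/-- Size (number of in-links) at time `t` of the page chosen uniformly at random at time `t`. -/
def pageSize (gap : ℕ → Ω → ℝ) (X : ℕ → ℝ≥0 → Ω → ℕ) (pick : ℝ → Ω → ℕ) (t : ℝ) (ω : Ω) : ℕ :=
  X (pick t ω) (t - birthTime gap (pick t ω) ω).toNNReal ω

/-- Saturating rates `λ r (N - r)` for `1 ≤ r ≤ N`. They vanish at `r = N`, so that states above
`N` are never reached; the rates there are set to `0`. -/
def saturatingRate (lam : ℝ) (N r : ℕ) : ℝ :=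
  if r ≤ N then lam * r * ((N : ℝ) - r) else 0

/-- The closed form with the factors `Γ(1 - N/2 ± √(N² + 4/ρ)/2)`. -/
def closedForm₁ (N : ℕ) (ρ : ℝ) (n : ℕ) : ℝ :=
  ((-1) ^ n / ρ) * (Real.Gamma n * Real.Gamma N / Real.Gamma ((N : ℝ) - n + 1))
    * (Real.Gamma (1 - (N : ℝ) / 2 - (1 / 2) * √((N : ℝ) ^ 2 + 4 / ρ))
        / Real.Gamma (n + 1 - (N : ℝ) / 2 - (1 / 2) * √((N : ℝ) ^ 2 + 4 / ρ)))
    * (Real.Gamma (1 - (N : ℝ) / 2 + (1 / 2) * √((N : ℝ) ^ 2 + 4 / ρ))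
        / Real.Gamma (n + 1 - (N : ℝ) / 2 + (1 / 2) * √((N : ℝ) ^ 2 + 4 / ρ)))

/-- The closed form all of whose Gamma factors have positive argument for `1 ≤ n ≤ N`, `ρ > 0`. -/
def closedForm₂ (N : ℕ) (ρ : ℝ) (n : ℕ) : ℝ :=
  ρ⁻¹ * (Real.Gamma n * Real.Gamma N / Real.Gamma ((N : ℝ) - n + 1))
    * (Real.Gamma ((1 / 2) * √((N : ℝ) ^ 2 + 4 / ρ) + 1 - (N : ℝ) / 2)
        / Real.Gamma ((1 / 2) * √((N : ℝ) ^ 2 + 4 / ρ) + 1 - (N : ℝ) / 2 + n))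
    * (Real.Gamma ((1 / 2) * √((N : ℝ) ^ 2 + 4 / ρ) + (N : ℝ) / 2 - n)
        / Real.Gamma ((1 / 2) * √((N : ℝ) ^ 2 + 4 / ρ) + (N : ℝ) / 2))

end

end YuleNetwork

/-!
By independence, and since right-continuous paths are jointly measurable, the law of the size of the
random page is the expected average, over the pages present, of the common state probability `p_n`
evaluated at their ages. For the creation times of a Yule process `T_k - log k / β` converges almost
surely (a square-summable martingale plus the harmonic sums), so in the average over `⌊x K⌋`,
`0 < x < 1`, of `K` pages the age of page `⌊x K⌋` tends to `-log x / β`: the ages become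
exponentially distributed with parameter `β`, and the limit is the Laplace transform
`β ∫ exp (-β s) p_n(s) ds`.

Integrated fractionally, the birth system becomes a Volterra equation with kernel
`t ^ (ν - 1) / Γ(ν)`, whose Laplace transform is `β ^ (-ν)`. At `β` the fractional system is
therefore the recursion of a Markov chain that moves from `r` to `r + 1` with probability
`λ_r / (β ^ ν + λ_r)` and stops otherwise. For `λ_r = λ r (N - r)` the quadratic
`1 + ρ r (N - r)` factors with roots `N / 2 ± b`, which turns the product into Gamma quotients.
-/

namespace YuleNetwork

/-! ### The stopped chain and the closed forms -/

/-- Law of the state in which a pure birth chain started at `1` is stopped: in state `r` the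
chain moves to `r + 1` with probability `c r / (1 + c r)` and is stopped otherwise. For a birth
process with rates `c r` this is the state at an independent standard exponential time. -/
noncomputable def stoppedChainMass (c : ℕ → ℝ) (n : ℕ) : ℝ :=
  (∏ r ∈ Finset.Ico 1 n, c r / (1 + c r)) * (1 + c n)⁻¹

section StoppedChain

variable {c : ℕ → ℝ} {n : ℕ}

theorem stoppedChainMass_one : stoppedChainMass c 1 = (1 + c 1)⁻¹ := by
  simp [stoppedChainMass]

theorem stoppedChainMass_succ (hn : 1 ≤ n) :
    stoppedChainMass c (n + 1) = c n * stoppedChainMass c n / (1 + c (n + 1)) := by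
  rw [stoppedChainMass, stoppedChainMass, Finset.prod_Ico_succ_top hn]
  ring

theorem stoppedChainMass_eq_prod_div_prod (hn : 1 ≤ n) :
    stoppedChainMass c n = (∏ r ∈ Finset.Ico 1 n, c r) / ∏ r ∈ Finset.Icc 1 n, (1 + c r) := by
  rw [stoppedChainMass, Finset.prod_div_distrib, ← Finset.Ico_succ_right_eq_Icc,
    Order.succ_eq_add_one, Finset.prod_Ico_succ_top hn, div_mul_eq_div_div,
    div_eq_mul_inv _ (1 + c n)]

theorem sum_stoppedChainMass (hc : ∀ r, 1 + c r ≠ 0) (m : ℕ) :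
    ∑ n ∈ Finset.Icc 1 m, stoppedChainMass c n = 1 - ∏ r ∈ Finset.Icc 1 m, c r / (1 + c r) := by
  induction m with
  | zero => simp
  | succ m ih =>
    rw [Finset.sum_Icc_succ_top (by lia), Finset.prod_Icc_succ_top (by lia), ih, stoppedChainMass,
      ← Finset.Ico_succ_right_eq_Icc, Order.succ_eq_add_one]
    have := hc (m + 1)
    field_simp
    ring

theorem continuousAt_stoppedChainMass {E : Type*} [TopologicalSpace E] {c : E → ℕ → ℝ} {x : E}
    (hcont : ∀ r, ContinuousAt (fun y => c y r) x) (hc : ∀ r, 1 + c x r ≠ 0) (n : ℕ) :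
    ContinuousAt (fun y => stoppedChainMass (c y) n) x :=
  (tendsto_finsetProd _ fun r _ => (hcont r).div (continuousAt_const.add (hcont r)) (hc r)).mul
    ((continuousAt_const.add (hcont n)).inv₀ (hc n))

end StoppedChain

section SaturatingRate

variable {lam ρ : ℝ} {N r n : ℕ}

theorem saturatingRate_nonneg (hlam : 0 ≤ lam) (N r : ℕ) : 0 ≤ saturatingRate lam N r := by
  unfold saturatingRate
  split_ifs with h
  · have : (r : ℝ) ≤ N := by exact_mod_cast h
    exact mul_nonneg (by positivity) (by linarith)
  · rfl

theorem saturatingRate_of_le (h : r ≤ N) : saturatingRate lam N r = lam * (r * ((N : ℝ) - r)) := by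
  rw [saturatingRate, if_pos h, mul_assoc]

theorem saturatingRate_self (lam : ℝ) (N : ℕ) : saturatingRate lam N N = 0 := by
  simp [saturatingRate]

theorem saturatingRate_div (lam a : ℝ) (N r : ℕ) :
    saturatingRate (lam / a) N r = saturatingRate lam N r / a := by
  unfold saturatingRate
  split_ifs <;> ring

theorem continuous_saturatingRate (N r : ℕ) : Continuous fun lam => saturatingRate lam N r := by
  unfold saturatingRate
  split_ifs <;> fun_prop

theorem sum_stoppedChainMass_saturatingRate (hlam : 0 ≤ lam) (hN : 1 ≤ N) :
    ∑ n ∈ Finset.Icc 1 N, stoppedChainMass (saturatingRate lam N) n = 1 := by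
  have hc : ∀ r, 1 + saturatingRate lam N r ≠ 0 := fun r => by
    linarith [saturatingRate_nonneg hlam N r]
  rw [sum_stoppedChainMass hc, Finset.prod_eq_zero (Finset.mem_Icc.2 ⟨hN, le_rfl⟩), sub_zero]
  simp [saturatingRate_self]

theorem tendsto_stoppedChainMass_saturatingRate (hlam : 0 ≤ lam) (N n : ℕ) :
    Tendsto (fun x => stoppedChainMass (saturatingRate x N) n) (𝓝 lam)
      (𝓝 (stoppedChainMass (saturatingRate lam N) n)) :=
  continuousAt_stoppedChainMass (fun r => (continuous_saturatingRate N r).continuousAt)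
    (fun r => by linarith [saturatingRate_nonneg hlam N r]) n

end SaturatingRate

section GammaQuotients

variable {a c ρ : ℝ} {N n : ℕ}

theorem Gamma_div_Gamma_add_nat (ha : ∀ m : ℕ, a + 1 ≠ -(m : ℝ)) (n : ℕ) :
    Real.Gamma (a + 1) / Real.Gamma (a + 1 + n) = (∏ r ∈ Finset.Icc 1 n, (a + r))⁻¹ := by
  induction n with
  | zero => simp [div_self (Real.Gamma_ne_zero ha)]
  | succ n ih =>
    have h0 : a + 1 + n ≠ 0 := fun h => ha n (by linarith)
    rw [Finset.prod_Icc_succ_top (by lia), mul_inv, ← ih, Nat.cast_succ, ← add_assoc,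
      Real.Gamma_add_one h0, show a + 1 + n = a + (n + 1) by ring,
      div_mul_eq_div_div_swap, div_eq_mul_inv _ (a + _)]

theorem Gamma_sub_nat_div_Gamma (hc : (n : ℝ) < c) :
    Real.Gamma (c - n) / Real.Gamma c = (∏ r ∈ Finset.Icc 1 n, (c - r))⁻¹ := by
  induction n with
  | zero => simp [div_self (Real.Gamma_pos_of_pos (by simpa using hc)).ne']
  | succ n ih =>
    push_cast at hc
    have h0 : c - (n + 1) ≠ 0 := by linarith
    have h1 : Real.Gamma (c - n) = (c - (n + 1)) * Real.Gamma (c - (n + 1)) := by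
      rw [← Real.Gamma_add_one h0]
      ring_nf
    rw [Finset.prod_Icc_succ_top (by lia), mul_inv, ← ih (by linarith), h1, Nat.cast_succ]
    field_simp

theorem prod_mul_sub_eq_Gamma (hn : 1 ≤ n) (hnN : n ≤ N) :
    ∏ r ∈ Finset.Ico 1 n, ((r : ℝ) * ((N : ℝ) - r))
      = Real.Gamma n * Real.Gamma N / Real.Gamma ((N : ℝ) - n + 1) := by
  induction n, hn using Nat.le_induction with
  | base =>
    have : Real.Gamma N ≠ 0 := (Real.Gamma_pos_of_pos (by exact_mod_cast hnN)).ne'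
    simp [this]
  | succ n hn ih =>
    have hnN' : (n : ℝ) + 1 ≤ N := by exact_mod_cast hnN
    have hn0 : (n : ℝ) ≠ 0 := by positivity
    have hNn : (N : ℝ) - n ≠ 0 := by linarith
    have hG : Real.Gamma ((N : ℝ) - n) ≠ 0 := (Real.Gamma_pos_of_pos (by linarith)).ne'
    rw [Finset.prod_Ico_succ_top hn, ih (by lia), Nat.cast_succ, Real.Gamma_add_one hn0,
      Real.Gamma_add_one hNn, show (N : ℝ) - (n + 1) + 1 = N - n by ring]
    field_simp

theorem stoppedChainMass_saturatingRate (hρ : ρ ≠ 0) (hn : 1 ≤ n) (hnN : n ≤ N) :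
    stoppedChainMass (saturatingRate ρ N) n
      = ρ⁻¹ * (Real.Gamma n * Real.Gamma N / Real.Gamma ((N : ℝ) - n + 1))
        * (∏ r ∈ Finset.Icc 1 n, (ρ⁻¹ + r * ((N : ℝ) - r)))⁻¹ := by
  have hnum : ∏ r ∈ Finset.Ico 1 n, saturatingRate ρ N r
      = ρ ^ (n - 1) * (Real.Gamma n * Real.Gamma N / Real.Gamma ((N : ℝ) - n + 1)) := by
    rw [← prod_mul_sub_eq_Gamma hn hnN, ← Nat.card_Ico 1 n, Finset.pow_card_mul_prod]
    exact Finset.prod_congr rfl fun r hr =>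
      saturatingRate_of_le ((Finset.mem_Ico.1 hr).2.le.trans hnN)
  have hden : ∏ r ∈ Finset.Icc 1 n, (1 + saturatingRate ρ N r)
      = ρ ^ n * ∏ r ∈ Finset.Icc 1 n, (ρ⁻¹ + r * ((N : ℝ) - r)) := by
    rw [show ρ ^ n = ρ ^ (Finset.Icc 1 n).card by simp, Finset.pow_card_mul_prod]
    refine Finset.prod_congr rfl fun r hr => ?_
    rw [saturatingRate_of_le ((Finset.mem_Icc.1 hr).2.trans hnN), mul_add, mul_inv_cancel₀ hρ]
  have hpow : ρ ^ n = ρ ^ (n - 1) * ρ := by rw [← pow_succ, Nat.sub_add_cancel hn]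
  rw [stoppedChainMass_eq_prod_div_prod hn, hnum, hden, hpow]
  field_simp

end GammaQuotients

section ClosedForms

variable {ρ : ℝ} {N n : ℕ}

theorem lt_sqrt_sq_add (N : ℕ) (hρ : 0 < ρ) : (N : ℝ) < √((N : ℝ) ^ 2 + 4 / ρ) :=
  Real.lt_sqrt_of_sq_lt (lt_add_of_pos_right _ (by positivity))

theorem sq_sqrt_sq_add (N : ℕ) (hρ : 0 < ρ) :
    √((N : ℝ) ^ 2 + 4 / ρ) ^ 2 = (N : ℝ) ^ 2 + 4 * ρ⁻¹ := by
  rw [Real.sq_sqrt (by positivity), div_eq_mul_inv]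

/- Both closed forms come from the factorization
`ρ⁻¹ + r (N - r) = (b - N / 2 + r) (b + N / 2 - r)` with `b = √(N ^ 2 + 4 / ρ) / 2`. -/
theorem closedForm₂_eq_stoppedChainMass (hρ : 0 < ρ) (hn : 1 ≤ n) (hnN : n ≤ N) :
    closedForm₂ N ρ n = stoppedChainMass (saturatingRate ρ N) n := by
  have hs := lt_sqrt_sq_add N hρ
  have hs2 := sq_sqrt_sq_add N hρ
  have hnN' : (n : ℝ) ≤ N := by exact_mod_cast hnN
  rw [stoppedChainMass_saturatingRate hρ.ne' hn hnN, closedForm₂]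
  set b := (1 / 2) * √((N : ℝ) ^ 2 + 4 / ρ) with hb
  have hpole : ∀ m : ℕ, b - (N : ℝ) / 2 + 1 ≠ -(m : ℝ) := fun m h => by
    linarith [m.cast_nonneg (α := ℝ)]
  rw [show b + 1 - (N : ℝ) / 2 = b - N / 2 + 1 by ring, Gamma_div_Gamma_add_nat hpole,
    Gamma_sub_nat_div_Gamma (by linarith), mul_assoc, ← mul_inv, ← Finset.prod_mul_distrib]
  congr 2
  refine Finset.prod_congr rfl fun r _ => ?_
  linear_combination (1 / 4) * hs2 + (b + (1 / 2) * √((N : ℝ) ^ 2 + 4 / ρ)) * hb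

theorem closedForm₁_eq_stoppedChainMass (hρ : 0 < ρ) (hn : 1 ≤ n) (hnN : n ≤ N)
    (hpole : ∀ m : ℕ, 1 - (N : ℝ) / 2 - (1 / 2) * √((N : ℝ) ^ 2 + 4 / ρ) ≠ -(m : ℝ)) :
    closedForm₁ N ρ n = stoppedChainMass (saturatingRate ρ N) n := by
  have hs := lt_sqrt_sq_add N hρ
  have hs2 := sq_sqrt_sq_add N hρ
  rw [stoppedChainMass_saturatingRate hρ.ne' hn hnN, closedForm₁]
  set b := (1 / 2) * √((N : ℝ) ^ 2 + 4 / ρ) with hb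
  have hpole₁ : ∀ m : ℕ, -(N : ℝ) / 2 - b + 1 ≠ -(m : ℝ) := fun m h => hpole m (by linarith)
  have hpole₂ : ∀ m : ℕ, -(N : ℝ) / 2 + b + 1 ≠ -(m : ℝ) := fun m h => by
    linarith [m.cast_nonneg (α := ℝ)]
  have hprod : (∏ r ∈ Finset.Icc 1 n, (-(N : ℝ) / 2 - b + r))
        * ∏ r ∈ Finset.Icc 1 n, (-(N : ℝ) / 2 + b + r)
      = (-1) ^ n * ∏ r ∈ Finset.Icc 1 n, (ρ⁻¹ + r * ((N : ℝ) - r)) := by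
    rw [show (-1 : ℝ) ^ n = (-1) ^ (Finset.Icc 1 n).card by simp, Finset.pow_card_mul_prod,
      ← Finset.prod_mul_distrib]
    refine Finset.prod_congr rfl fun r _ => ?_
    linear_combination (-1 / 4) * hs2 - (b + (1 / 2) * √((N : ℝ) ^ 2 + 4 / ρ)) * hb
  rw [show 1 - (N : ℝ) / 2 - b = -(N : ℝ) / 2 - b + 1 by ring,
    show n + 1 - (N : ℝ) / 2 - b = -(N : ℝ) / 2 - b + 1 + n by ring,
    show 1 - (N : ℝ) / 2 + b = -(N : ℝ) / 2 + b + 1 by ring,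
    show n + 1 - (N : ℝ) / 2 + b = -(N : ℝ) / 2 + b + 1 + n by ring,
    Gamma_div_Gamma_add_nat hpole₁, Gamma_div_Gamma_add_nat hpole₂, mul_assoc _ (_⁻¹) (_⁻¹),
    ← mul_inv, hprod, mul_inv, ← inv_pow, inv_neg_one]
  have hsign : ((-1 : ℝ) ^ n) * (-1) ^ n = 1 := by rw [← mul_pow]; simp
  linear_combination (ρ⁻¹ * (Real.Gamma n * Real.Gamma N / Real.Gamma ((N : ℝ) - n + 1)) *
    (∏ r ∈ Finset.Icc 1 n, (ρ⁻¹ + r * ((N : ℝ) - r)))⁻¹) * hsign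

theorem inv_eq_intCast_of_pole (hρ : 0 < ρ) {m : ℕ}
    (h : 1 - (N : ℝ) / 2 - (1 / 2) * √((N : ℝ) ^ 2 + 4 / ρ) = -(m : ℝ)) :
    ρ⁻¹ = (((m + 1) * (m + 1 - N) : ℤ) : ℝ) := by
  have hs : √((N : ℝ) ^ 2 + 4 / ρ) = 2 * m + 2 - N := by linarith
  have hs2 := sq_sqrt_sq_add N hρ
  rw [hs] at hs2
  push_cast
  linarith

theorem eventually_ne_intCast (y : ℝ) : ∀ᶠ x in 𝓝[≠] y, ∀ m : ℤ, x ≠ (m : ℝ) := by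
  have hclosed : IsClosed (((↑) : ℤ → ℝ) '' {m | (m : ℝ) ≠ y}) :=
    Int.isClosedEmbedding_coe_real.isClosedMap _ (isClosed_discrete _)
  have hy : y ∈ (((↑) : ℤ → ℝ) '' {m | (m : ℝ) ≠ y})ᶜ := fun ⟨_, hm, h⟩ => hm h
  filter_upwards [nhdsWithin_le_nhds (hclosed.isOpen_compl.mem_nhds hy), self_mem_nhdsWithin]
    with x hx hxy m hm
  exact hx ⟨m, fun h => hxy (hm.trans h), hm.symm⟩

theorem eventually_forall_ne_pole (N : ℕ) (hρ : 0 < ρ) :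
    ∀ᶠ x in 𝓝[≠] ρ, ∀ m : ℕ,
      1 - (N : ℝ) / 2 - (1 / 2) * √((N : ℝ) ^ 2 + 4 / x) ≠ -(m : ℝ) := by
  have hinv : Tendsto (·⁻¹) (𝓝[≠] ρ) (𝓝[≠] ρ⁻¹) :=
    (hasDerivAt_inv hρ.ne').tendsto_nhdsNE (by simp [hρ.ne'])
  filter_upwards [hinv.eventually (eventually_ne_intCast ρ⁻¹),
    nhdsWithin_le_nhds (lt_mem_nhds hρ)] with x hx hx0 m hm
  exact hx _ (inv_eq_intCast_of_pole hx0 hm)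

theorem tendsto_closedForm₁ (hρ : 0 < ρ) (hn : 1 ≤ n) (hnN : n ≤ N) :
    Tendsto (fun x => closedForm₁ N x n) (𝓝[≠] ρ) (𝓝 (closedForm₂ N ρ n)) := by
  rw [closedForm₂_eq_stoppedChainMass hρ hn hnN]
  refine ((tendsto_stoppedChainMass_saturatingRate hρ.le N n).mono_left nhdsWithin_le_nhds).congr'
    ?_
  filter_upwards [nhdsWithin_le_nhds (lt_mem_nhds hρ), eventually_forall_ne_pole N hρ]
    with x hx hpole
  exact (closedForm₁_eq_stoppedChainMass hx hn hnN hpole).symm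

theorem sum_closedForm₂ (hρ : 0 < ρ) (hN : 1 ≤ N) :
    ∑ n ∈ Finset.Icc 1 N, closedForm₂ N ρ n = 1 := by
  rw [← sum_stoppedChainMass_saturatingRate hρ.le hN]
  refine Finset.sum_congr rfl fun n hn => ?_
  obtain ⟨hn, hnN⟩ := Finset.mem_Icc.1 hn
  exact closedForm₂_eq_stoppedChainMass hρ hn hnN

theorem closedForm₂_one_div_add_one (hn : 1 ≤ n) (hnN : n ≤ N) :
    closedForm₂ N (1 / ((N : ℝ) + 1)) n = (1 + 1 / (N : ℝ)) * (1 / ((n : ℝ) ^ 2 + n)) := by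
  have hn0 : (0 : ℝ) < n := by exact_mod_cast hn
  have hnN' : (n : ℝ) ≤ N := by exact_mod_cast hnN
  have hN0 : (0 : ℝ) < N := hn0.trans_le hnN'
  have hs : √((N : ℝ) ^ 2 + 4 / (1 / ((N : ℝ) + 1))) = N + 2 := by
    rw [Real.sqrt_eq_iff_eq_sq (by positivity) (by positivity)]
    field_simp
    ring
  rw [closedForm₂, hs, show (1 / 2 : ℝ) * (N + 2) + 1 - N / 2 = 2 by ring,
    show (1 / 2 : ℝ) * (N + 2) + N / 2 - n = N - n + 1 by ring,
    show (1 / 2 : ℝ) * (N + 2) + N / 2 = N + 1 by ring, show (2 : ℝ) + n = n + 1 + 1 by ring,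
    Real.Gamma_two, Real.Gamma_add_one (s := (n : ℝ) + 1) (by positivity),
    Real.Gamma_add_one hn0.ne', Real.Gamma_add_one hN0.ne']
  have h₁ : Real.Gamma n ≠ 0 := (Real.Gamma_pos_of_pos hn0).ne'
  have h₂ : Real.Gamma N ≠ 0 := (Real.Gamma_pos_of_pos hN0).ne'
  have h₃ : Real.Gamma ((N : ℝ) - n + 1) ≠ 0 := (Real.Gamma_pos_of_pos (by linarith)).ne'
  field_simp

end ClosedForms

/-! ### Fractional integrals and Laplace transforms -/

/-- The kernel `x ^ (a - 1) / Γ(a)` of the Riemann–Liouville fractional integral of order `a`. -/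
noncomputable def fracKernel (a x : ℝ) : ℝ :=
  x ^ (a - 1) / Real.Gamma a

/-- The Riemann–Liouville fractional integral of order `a` with base point `0`. -/
noncomputable def fracIntegral (a : ℝ) (g : ℝ → ℝ) (t : ℝ) : ℝ :=
  ∫ s in (0 : ℝ)..t, g s * fracKernel a (t - s)

/-- The Laplace transform of `f` at `c`. -/
noncomputable def laplace (f : ℝ → ℝ) (c : ℝ) : ℝ :=
  ∫ t in Set.Ioi (0 : ℝ), Real.exp (-c * t) * f t

section FracKernel

variable {a b c t u x : ℝ}

theorem fracKernel_nonneg (ha : 0 < a) (hx : 0 ≤ x) : 0 ≤ fracKernel a x :=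
  div_nonneg (Real.rpow_nonneg hx _) (Real.Gamma_pos_of_pos ha).le

theorem fracKernel_one (x : ℝ) : fracKernel 1 x = 1 := by
  simp [fracKernel]

theorem intervalIntegrable_fracKernel (ha : 0 < a) (u t : ℝ) :
    IntervalIntegrable (fracKernel a) volume u t :=
  (intervalIntegral.intervalIntegrable_rpow' (by linarith)).div_const _

theorem intervalIntegrable_mul_fracKernel_sub {g : ℝ → ℝ} (ha : 0 < a)
    (hg : ContinuousOn g (Set.uIcc 0 t)) :
    IntervalIntegrable (fun s => g s * fracKernel a (t - s)) volume 0 t := by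
  have h := (intervalIntegrable_fracKernel ha 0 t).comp_sub_left t
  simp only [sub_zero, sub_self] at h
  exact h.symm.continuousOn_mul hg

theorem fracIntegral_fracKernel (ha : 0 < a) (hb : 0 < b) (ht : 0 < t) :
    fracIntegral b (fracKernel a) t = fracKernel (a + b) t := by
  have hbeta : ∫ s in (0 : ℝ)..t, s ^ (a - 1) * (t - s) ^ (b - 1)
      = t ^ (a + b - 1) * (Real.Gamma a * Real.Gamma b / Real.Gamma (a + b)) := by
    have h := Complex.betaIntegral_scaled a b ht
    rw [Complex.betaIntegral_eq_Gamma_mul_div _ _ (by simpa using ha) (by simpa using hb),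
      Complex.Gamma_ofReal, Complex.Gamma_ofReal, ← Complex.ofReal_add, Complex.Gamma_ofReal] at h
    apply Complex.ofReal_injective
    push_cast [Complex.ofReal_cpow ht.le] at h ⊢
    rw [← h, ← intervalIntegral.integral_ofReal]
    refine intervalIntegral.integral_congr fun s hs => ?_
    rw [Set.uIcc_of_le ht.le] at hs
    push_cast [Complex.ofReal_cpow hs.1, Complex.ofReal_cpow (sub_nonneg.2 hs.2)]
    rfl
  have ha' := (Real.Gamma_pos_of_pos ha).ne'
  have hb' := (Real.Gamma_pos_of_pos hb).ne'
  simp only [fracIntegral, fracKernel, div_mul_div_comm, intervalIntegral.integral_div, hbeta]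
  field_simp

theorem exp_mul_fracKernel (c a t : ℝ) :
    Real.exp (-c * t) * fracKernel a t
      = t ^ (a - 1) * Real.exp (-(c * t)) / Real.Gamma a := by
  rw [fracKernel, neg_mul]
  ring

theorem integrableOn_exp_mul_fracKernel (ha : 0 < a) (hc : 0 < c) :
    IntegrableOn (fun t => Real.exp (-c * t) * fracKernel a t) (Set.Ioi 0) := by
  have h := integrableOn_rpow_mul_exp_neg_mul_rpow (p := 1) (s := a - 1) (by linarith) one_pos hc
  simp only [Real.rpow_one, neg_mul] at h
  simp only [exp_mul_fracKernel]
  exact h.div_const (Real.Gamma a)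

theorem laplace_fracKernel (ha : 0 < a) (hc : 0 < c) : laplace (fracKernel a) c = c ^ (-a) := by
  simp only [laplace, exp_mul_fracKernel, integral_div]
  rw [Real.integral_rpow_mul_exp_neg_mul_Ioi ha hc, one_div, Real.inv_rpow hc.le,
    Real.rpow_neg hc.le, mul_div_cancel_right₀ _ (Real.Gamma_pos_of_pos ha).ne']

end FracKernel

section Semigroup

open Set

local notation f " ⋆ᵣ " g:70 => convolution f g (ContinuousLinearMap.mul ℝ ℝ) volume

variable {a b t u : ℝ} {φ : ℝ → ℝ}

theorem convolution_eq_intervalIntegral {F G : ℝ → ℝ} (hu : 0 ≤ u)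
    (h : ∀ s ∉ Ioo 0 u, F s * G (u - s) = 0) :
    (F ⋆ᵣ G) u = ∫ s in (0 : ℝ)..u, F s * G (u - s) := by
  rw [convolution_def, intervalIntegral.integral_of_le hu, integral_Ioc_eq_integral_Ioo,
    ← integral_indicator measurableSet_Ioo]
  congr 1 with s
  by_cases hs : s ∈ Ioo 0 u
  · rw [indicator_of_mem hs, ContinuousLinearMap.mul_apply']
  · rw [indicator_of_notMem hs, ContinuousLinearMap.mul_apply', h s hs]

theorem convolution_indicator_fracKernel (φ : ℝ → ℝ) (a : ℝ) (hu : 0 ≤ u) (hut : u ≤ t) :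
    ((Ioo 0 t).indicator φ ⋆ᵣ (Ioo 0 t).indicator (fracKernel a)) u = fracIntegral a φ u := by
  rw [convolution_eq_intervalIntegral hu fun s hs => ?_, fracIntegral]
  · refine intervalIntegral.integral_congr_Ioo_of_le hu fun s hs => ?_
    obtain ⟨hs₁, hs₂⟩ := hs
    rw [indicator_of_mem (mem_Ioo.2 ⟨hs₁, by linarith⟩),
      indicator_of_mem (mem_Ioo.2 ⟨by linarith, by linarith⟩)]
  · simp only [indicator, mem_Ioo, not_and, not_lt] at hs ⊢
    split_ifs <;> grind

theorem integrable_indicator_fracKernel (ha : 0 < a) (t : ℝ) :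
    Integrable ((Ioo 0 t).indicator (fracKernel a)) :=
  (integrable_indicator_iff measurableSet_Ioo).2
    ((intervalIntegrable_fracKernel ha 0 t).1.mono_set Ioo_subset_Ioc_self)

theorem norm_indicator_fracKernel (ha : 0 < a) (t : ℝ) :
    (fun x => ‖(Ioo 0 t).indicator (fracKernel a) x‖) = (Ioo 0 t).indicator (fracKernel a) := by
  ext x
  exact Real.norm_of_nonneg (indicator_nonneg (fun x hx => fracKernel_nonneg ha hx.1.le) x)

theorem convolutionExistsAt_indicator (ha : 0 < a) (hb : 0 < b)
    (hφ : IntervalIntegrable (fun s => φ s * fracKernel (a + b) (t - s)) volume 0 t) :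
    ConvolutionExistsAt (fun x => ‖(Ioo 0 t).indicator φ x‖)
      ((fun x => ‖(Ioo 0 t).indicator (fracKernel a) x‖) ⋆ᵣ
        fun x => ‖(Ioo 0 t).indicator (fracKernel b) x‖) t
      (ContinuousLinearMap.mul ℝ ℝ) volume := by
  rw [norm_indicator_fracKernel ha, norm_indicator_fracKernel hb, ConvolutionExistsAt]
  refine ((integrable_indicator_iff measurableSet_Ioo).2
    (hφ.1.mono_set Ioo_subset_Ioc_self)).norm.congr (Eventually.of_forall fun s => ?_)
  simp only [ContinuousLinearMap.mul_apply']
  by_cases hs : s ∈ Ioo 0 t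
  · rw [convolution_indicator_fracKernel _ _ (by linarith [hs.2]) (by linarith [hs.1]),
      fracIntegral_fracKernel ha hb (by linarith [hs.2]), indicator_of_mem hs, indicator_of_mem hs,
      norm_mul, Real.norm_of_nonneg (fracKernel_nonneg (x := t - s) (by linarith : 0 < a + b)
        (by linarith [hs.2]))]
  · simp [hs]

theorem fracIntegral_fracIntegral (ha : 0 < a) (hb : 0 < b) (ht : 0 ≤ t)
    (hφ : IntervalIntegrable φ volume 0 t)
    (hφ' : IntervalIntegrable (fun s => φ s * fracKernel (a + b) (t - s)) volume 0 t) :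
    fracIntegral b (fracIntegral a φ) t = fracIntegral (a + b) φ t := by
  set f := (Ioo 0 t).indicator φ with hf
  set g := (Ioo 0 t).indicator (fracKernel a)
  set k := (Ioo 0 t).indicator (fracKernel b) with hk
  have hfi : Integrable f := (integrable_indicator_iff measurableSet_Ioo).2
    (hφ.1.mono_set Ioo_subset_Ioc_self)
  have hgi : Integrable g := integrable_indicator_fracKernel ha t
  have hki : Integrable k := integrable_indicator_fracKernel hb t
  have hleft : ((f ⋆ᵣ g) ⋆ᵣ k) t = fracIntegral b (fracIntegral a φ) t := by
    rw [convolution_eq_intervalIntegral ht fun s hs => ?_, fracIntegral]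
    · refine intervalIntegral.integral_congr_Ioo_of_le ht fun s hs => ?_
      rw [convolution_indicator_fracKernel φ a hs.1.le hs.2.le, hk,
        indicator_of_mem (mem_Ioo.2 ⟨by linarith [hs.2], by linarith [hs.1]⟩)]
    · rw [hk, indicator_of_notMem fun h => hs ⟨by linarith [h.2], by linarith [h.1]⟩, mul_zero]
  have hright : (f ⋆ᵣ (g ⋆ᵣ k)) t = fracIntegral (a + b) φ t := by
    rw [convolution_eq_intervalIntegral ht fun s hs => ?_, fracIntegral]
    · refine intervalIntegral.integral_congr_Ioo_of_le ht fun s hs => ?_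
      rw [convolution_indicator_fracKernel _ b (by linarith [hs.2]) (by linarith [hs.1]),
        fracIntegral_fracKernel ha hb (by linarith [hs.2]), hf, indicator_of_mem hs]
    · rw [hf, indicator_of_notMem hs, zero_mul]
  rw [← hleft, ← hright]
  exact convolution_assoc (μ := volume) (ν := volume) _ _ _ _ (fun x y z => by simp [mul_assoc])
    hfi.aestronglyMeasurable hgi.aestronglyMeasurable hki.aestronglyMeasurable
    (hfi.ae_convolution_exists _ hgi) (hgi.norm.ae_convolution_exists _ hki.norm)
    (convolutionExistsAt_indicator ha hb hφ')

end Semigroup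

section FracIntegral

open Set

variable {a b c M t : ℝ} {g h : ℝ → ℝ}

theorem fracIntegral_congr (ht : 0 ≤ t) (hgh : EqOn g h (Ioo 0 t)) :
    fracIntegral a g t = fracIntegral a h t :=
  intervalIntegral.integral_congr_Ioo_of_le ht fun s hs => by simp only [hgh hs]

theorem fracIntegral_const_mul (a b : ℝ) (g : ℝ → ℝ) (t : ℝ) :
    fracIntegral a (fun s => b * g s) t = b * fracIntegral a g t := by
  simp only [fracIntegral, mul_assoc, intervalIntegral.integral_const_mul]

theorem fracIntegral_sub (ha : 0 < a) (hg : ContinuousOn g (uIcc 0 t))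
    (hh : ContinuousOn h (uIcc 0 t)) :
    fracIntegral a (fun s => g s - h s) t = fracIntegral a g t - fracIntegral a h t := by
  simp only [fracIntegral, sub_mul]
  exact intervalIntegral.integral_sub (intervalIntegrable_mul_fracKernel_sub ha hg)
    (intervalIntegrable_mul_fracKernel_sub ha hh)

theorem caputoDeriv_eq_fracIntegral_deriv (ha : a ≠ 1) (g : ℝ → ℝ) (ht : 0 ≤ t) :
    caputoDeriv a g t = fracIntegral (1 - a) (deriv g) t := by
  rw [caputoDeriv, if_neg ha, fracIntegral, ← intervalIntegral.integral_const_mul]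
  refine intervalIntegral.integral_congr_Ioo_of_le ht fun s hs => ?_
  rw [fracKernel, show 1 - a - 1 = -a by ring, Real.rpow_neg (by linarith [hs.2])]
  ring

theorem fracIntegral_caputoDeriv (ha₀ : 0 < a) (ha₁ : a ≤ 1) (ht : 0 ≤ t)
    (hg : AbsolutelyContinuousOnInterval g 0 t) :
    fracIntegral a (caputoDeriv a g) t = g t - g 0 := by
  rw [← hg.integral_deriv_eq_sub]
  rcases ha₁.eq_or_lt with rfl | ha₁
  · simp [fracIntegral, caputoDeriv, fracKernel_one]
  · rw [fracIntegral_congr ht fun s hs => caputoDeriv_eq_fracIntegral_deriv ha₁.ne g hs.1.le,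
      fracIntegral_fracIntegral (sub_pos.2 ha₁) ha₀ ht hg.intervalIntegrable_deriv
        (by simpa [fracKernel_one] using hg.intervalIntegrable_deriv)]
    simp [fracIntegral, fracKernel_one]

theorem exp_mul_fracIntegral (c a : ℝ) (g : ℝ → ℝ) (t : ℝ) :
    Real.exp (-c * t) * fracIntegral a g t
      = ∫ s in (0 : ℝ)..t, ContinuousLinearMap.mul ℝ ℝ (Real.exp (-c * s) * g s)
          (Real.exp (-c * (t - s)) * fracKernel a (t - s)) := by
  rw [fracIntegral, ← intervalIntegral.integral_const_mul]
  congr 1 with s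
  rw [ContinuousLinearMap.mul_apply', show -c * t = -c * s + -c * (t - s) by ring, Real.exp_add]
  ring

theorem laplace_fracIntegral (ha : 0 < a) (hc : 0 < c)
    (hg : IntegrableOn (fun s => Real.exp (-c * s) * g s) (Ioi 0)) :
    laplace (fracIntegral a g) c = c ^ (-a) * laplace g c := by
  simp only [laplace, exp_mul_fracIntegral]
  rw [integral_posConvolution hg (integrableOn_exp_mul_fracKernel ha hc)
      (ContinuousLinearMap.mul ℝ ℝ),
    ContinuousLinearMap.mul_apply', ← laplace_fracKernel ha hc, laplace, mul_comm]

theorem integrableOn_exp_mul_fracIntegral (ha : 0 < a) (hc : 0 < c)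
    (hg : IntegrableOn (fun s => Real.exp (-c * s) * g s) (Ioi 0)) :
    IntegrableOn (fun t => Real.exp (-c * t) * fracIntegral a g t) (Ioi 0) := by
  have h := integrable_posConvolution hg (integrableOn_exp_mul_fracKernel ha hc)
    (ContinuousLinearMap.mul ℝ ℝ)
  refine h.integrableOn.congr_fun (fun t ht => ?_) measurableSet_Ioi
  simp only [posConvolution, indicator_of_mem ht, exp_mul_fracIntegral]

theorem integrableOn_exp_mul_of_bounded (hc : 0 < c) (hg : Continuous g) (hM : ∀ t, |g t| ≤ M) :
    IntegrableOn (fun s => Real.exp (-c * s) * g s) (Ioi 0) :=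
  (integrableOn_exp_mul_Ioi (neg_neg_of_pos hc) 0).mul_bdd (c := M) hg.aestronglyMeasurable
    (ae_of_all _ hM)

theorem abs_fracIntegral_le_of_abs_le_exp (ha : 0 < a) (hc : 0 < c) (ht : 0 ≤ t)
    (hg : ∀ s ∈ Icc 0 t, |g s| ≤ M * Real.exp (c * s)) :
    |fracIntegral a g t| ≤ M * (c ^ (-a) * Real.exp (c * t)) := by
  have hM : 0 ≤ M := by simpa using (abs_nonneg _).trans (hg 0 ⟨le_rfl, ht⟩)
  set w : ℝ → ℝ := fun s => Real.exp (-c * s) * fracKernel a s with hw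
  have hint : IntegrableOn w (Ioi 0) := integrableOn_exp_mul_fracKernel ha hc
  have hw_int : IntervalIntegrable w volume 0 t :=
    (intervalIntegrable_iff_integrableOn_Ioc_of_le ht).2 (hint.mono_set Ioc_subset_Ioi_self)
  have hw_le : ∫ s in (0 : ℝ)..t, w s ≤ c ^ (-a) := by
    rw [← laplace_fracKernel ha hc, intervalIntegral.integral_of_le ht]
    refine setIntegral_mono_set hint ?_ (ae_of_all _ Ioc_subset_Ioi_self)
    exact (ae_restrict_iff' measurableSet_Ioi).2 (ae_of_all _ fun s hs =>
      mul_nonneg (Real.exp_pos _).le (fracKernel_nonneg ha (le_of_lt hs)))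
  calc |fracIntegral a g t|
      ≤ ∫ s in (0 : ℝ)..t, M * Real.exp (c * t) * w (t - s) := by
        rw [← Real.norm_eq_abs]
        refine intervalIntegral.norm_integral_le_of_norm_le ht (ae_of_all _ fun s hs => ?_)
          (by simpa using (hw_int.comp_sub_left t).symm.const_mul (M * Real.exp (c * t)))
        have hk := fracKernel_nonneg ha (sub_nonneg.2 hs.2)
        rw [norm_mul, Real.norm_of_nonneg hk, hw, ← mul_assoc, mul_assoc M, ← Real.exp_add,
          show c * t + -c * (t - s) = c * s by ring]
        exact mul_le_mul_of_nonneg_right (hg s ⟨hs.1.le, hs.2⟩) hk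
    _ = M * Real.exp (c * t) * ∫ s in (0 : ℝ)..t, w s := by
        rw [intervalIntegral.integral_const_mul, intervalIntegral.integral_comp_sub_left w t]
        simp
    _ ≤ M * Real.exp (c * t) * c ^ (-a) := by gcongr
    _ = M * (c ^ (-a) * Real.exp (c * t)) := by ring

/- For `c` large the operator `b • fracIntegral a` is a contraction for the norm
`sup |g t| exp (-c t)`. -/
theorem eq_zero_of_eq_mul_fracIntegral (ha : 0 < a) (hg : ContinuousOn g (Icc 0 t))
    (h : ∀ u ∈ Icc 0 t, g u = b * fracIntegral a g u) : ∀ u ∈ Icc 0 t, g u = 0 := by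
  intro v hv
  obtain ⟨c, hc, hbc⟩ : ∃ c : ℝ, 0 < c ∧ |b| * c ^ (-a) < 1 := by
    have h0 : Tendsto (fun c : ℝ => |b| * c ^ (-a)) atTop (𝓝 0) := by
      simpa using (tendsto_rpow_neg_atTop ha).const_mul |b|
    exact ((eventually_gt_atTop 0).and (h0.eventually_lt_const one_pos)).exists
  obtain ⟨u, hu, hmax⟩ := isCompact_Icc.exists_isMaxOn (nonempty_of_mem hv)
    (f := fun s => |g s| * Real.exp (-(c * s))) (by fun_prop)
  set M := |g u| * Real.exp (-(c * u)) with hM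
  have hgM : ∀ s ∈ Icc 0 t, |g s| ≤ M * Real.exp (c * s) := fun s hs => by
    rw [← div_le_iff₀ (Real.exp_pos _), div_eq_mul_inv, ← Real.exp_neg]
    exact hmax hs
  have hcontract : M ≤ |b| * c ^ (-a) * M := by
    have hu' := abs_fracIntegral_le_of_abs_le_exp ha hc hu.1
      fun s hs => hgM s ⟨hs.1, hs.2.trans hu.2⟩
    calc M = |b| * |fracIntegral a g u| * Real.exp (-(c * u)) := by rw [hM, h u hu, abs_mul]
      _ ≤ |b| * (M * (c ^ (-a) * Real.exp (c * u))) * Real.exp (-(c * u)) := by gcongr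
      _ = |b| * c ^ (-a) * M := by rw [Real.exp_neg]; field_simp
  have hM0 : M ≤ 0 := by nlinarith
  exact abs_nonpos_iff.1 ((hgM v hv).trans (mul_nonpos_of_nonpos_of_nonneg hM0 (by positivity)))

end FracIntegral

section Laplace

variable {f g : ℝ → ℝ} {a c : ℝ}

theorem laplace_const (hc : 0 < c) (a : ℝ) : laplace (fun _ => a) c = a / c := by
  rw [laplace, integral_mul_const, integral_exp_mul_Ioi (neg_neg_of_pos hc)]
  simp [div_eq_inv_mul]

theorem laplace_const_mul (a : ℝ) (f : ℝ → ℝ) (c : ℝ) :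
    laplace (fun t => a * f t) c = a * laplace f c := by
  simp only [laplace, mul_left_comm _ a, integral_const_mul]

theorem laplace_add
    (hf : IntegrableOn (fun t => Real.exp (-c * t) * f t) (Set.Ioi 0))
    (hg : IntegrableOn (fun t => Real.exp (-c * t) * g t) (Set.Ioi 0)) :
    laplace (fun t => f t + g t) c = laplace f c + laplace g c := by
  simp only [laplace, mul_add]
  exact integral_add hf hg

theorem laplace_congr (h : Set.EqOn f g (Set.Ioi 0)) : laplace f c = laplace g c :=
  setIntegral_congr_fun measurableSet_Ioi fun t ht => by simp only [h ht]

end Laplace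

section StateProb

variable {Ω : Type*} [MeasurableSpace Ω] {μ : Measure Ω} {ν : ℝ} {rate : ℕ → ℝ}
  {Y Y' : ℝ≥0 → Ω → ℕ}

theorem abs_stateProb_le_one [IsProbabilityMeasure μ] (Y : ℝ≥0 → Ω → ℕ) (n : ℕ) (t : ℝ) :
    |stateProb μ Y n t| ≤ 1 := by
  rw [stateProb, abs_of_nonneg measureReal_nonneg]
  exact measureReal_le_one

namespace IsFractionalBirthProcess

theorem continuous_stateProb (h : IsFractionalBirthProcess μ ν rate Y) (n : ℕ) :
    Continuous (stateProb μ Y n) := by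
  have hcont : ContinuousOn (stateProb μ Y n) (Set.Ici 0) := by
    intro t ht
    have ht' : 0 ≤ t := ht
    have h' := (h.absCont n (t + 1) (by linarith)).continuousOn
    rw [Set.uIcc_of_le (by linarith)] at h'
    refine (h' t ⟨ht, by linarith⟩).mono_of_mem_nhdsWithin ?_
    rw [← Set.Ici_inter_Iic]
    exact Filter.inter_mem self_mem_nhdsWithin (nhdsWithin_le_nhds (Iic_mem_nhds (by linarith)))
  have hmax : stateProb μ Y n = fun t => stateProb μ Y n (max t 0) := by
    ext t
    have : (max t 0).toNNReal = t.toNNReal := by ext; simp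
    simp only [stateProb, this]
  rw [hmax]
  exact hcont.comp_continuous (by fun_prop) fun t => Set.mem_Ici.2 (le_max_right _ _)

theorem stateProb_zero (h : IsFractionalBirthProcess μ ν rate Y) :
    stateProb μ Y 0 = fun _ => 0 := by
  ext t
  have hpos : ∀ ω, Y t.toNNReal ω ≠ 0 := fun ω => by
    have hmono : Y 0 ω ≤ Y t.toNNReal ω := h.mono ω (zero_le : 0 ≤ t.toNNReal)
    rw [h.start] at hmono
    lia
  simp [stateProb, hpos]

variable [IsProbabilityMeasure μ]

theorem stateProb_of_nonpos (h : IsFractionalBirthProcess μ ν rate Y) (n : ℕ) {t : ℝ}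
    (ht : t ≤ 0) : stateProb μ Y n t = if n = 1 then 1 else 0 := by
  simp only [stateProb, Real.toNNReal_of_nonpos ht, h.start]
  split_ifs with hn
  · simp [hn]
  · simp [Ne.symm hn]

theorem stateProb_succ_eq (h : IsFractionalBirthProcess μ ν rate Y) (hν₀ : 0 < ν) (hν₁ : ν ≤ 1)
    (n : ℕ) {t : ℝ} (ht : 0 ≤ t) :
    stateProb μ Y (n + 1) t = (if n = 0 then 1 else 0) + fracIntegral ν
      (fun u => -rate (n + 1) * stateProb μ Y (n + 1) u + rate n * stateProb μ Y n u) t := by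
  rw [← fracIntegral_congr ht fun u hu => h.equation n u hu.1,
    fracIntegral_caputoDeriv hν₀ hν₁ ht (h.absCont (n + 1) t ht), h.stateProb_of_nonpos _ le_rfl]
  simp

theorem stateProb_unique (h : IsFractionalBirthProcess μ ν rate Y)
    (h' : IsFractionalBirthProcess μ ν rate Y') (hν₀ : 0 < ν) (hν₁ : ν ≤ 1) (n : ℕ) :
    stateProb μ Y n = stateProb μ Y' n := by
  induction n with
  | zero => rw [h.stateProb_zero, h'.stateProb_zero]
  | succ n ih =>
    have hc := h.continuous_stateProb
    have hc' := h'.continuous_stateProb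
    have hdiff : ∀ t, 0 ≤ t → stateProb μ Y (n + 1) t - stateProb μ Y' (n + 1) t
        = -rate (n + 1) * fracIntegral ν
          (fun u => stateProb μ Y (n + 1) u - stateProb μ Y' (n + 1) u) t := fun t ht => by
      rw [h.stateProb_succ_eq hν₀ hν₁ n ht, h'.stateProb_succ_eq hν₀ hν₁ n ht, ih,
        add_sub_add_left_eq_sub, ← fracIntegral_sub hν₀ (by fun_prop) (by fun_prop),
        ← fracIntegral_const_mul]
      congr 1 with s
      ring
    ext t
    rcases le_total t 0 with ht | ht
    · rw [h.stateProb_of_nonpos _ ht, h'.stateProb_of_nonpos _ ht]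
    · exact sub_eq_zero.1 <| eq_zero_of_eq_mul_fracIntegral hν₀ ((hc _).sub (hc' _)).continuousOn
        (fun u hu => hdiff u hu.1) t ⟨ht, le_rfl⟩

theorem integrableOn_exp_mul_stateProb (h : IsFractionalBirthProcess μ ν rate Y) {c : ℝ}
    (hc : 0 < c) (n : ℕ) :
    IntegrableOn (fun s => Real.exp (-c * s) * stateProb μ Y n s) (Set.Ioi 0) :=
  integrableOn_exp_mul_of_bounded hc (h.continuous_stateProb n) (abs_stateProb_le_one Y n)

theorem laplace_stateProb_succ (h : IsFractionalBirthProcess μ ν rate Y) (hν₀ : 0 < ν)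
    (hν₁ : ν ≤ 1) {c : ℝ} (hc : 0 < c) (n : ℕ) :
    (1 + rate (n + 1) / c ^ ν) * (c * laplace (stateProb μ Y (n + 1)) c)
      = (if n = 0 then 1 else 0) + rate n / c ^ ν * (c * laplace (stateProb μ Y n) c) := by
  have hterm : ∀ (a : ℝ) (m : ℕ),
      IntegrableOn (fun t => Real.exp (-c * t) * (a * stateProb μ Y m t)) (Set.Ioi 0) :=
    fun a m => by
      simp only [mul_left_comm _ a]
      exact (h.integrableOn_exp_mul_stateProb hc m).const_mul a
  have hrhs : IntegrableOn (fun t => Real.exp (-c * t)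
      * (-rate (n + 1) * stateProb μ Y (n + 1) t + rate n * stateProb μ Y n t)) (Set.Ioi 0) := by
    simp only [mul_add]
    exact (hterm _ _).add (hterm _ _)
  have hconst : IntegrableOn (fun t => Real.exp (-c * t) * if n = 0 then 1 else 0) (Set.Ioi 0) :=
    integrableOn_exp_mul_of_bounded hc continuous_const fun _ => le_rfl
  have hlaplace := laplace_congr (c := c) fun t ht => h.stateProb_succ_eq hν₀ hν₁ n (le_of_lt ht)
  rw [laplace_add hconst (integrableOn_exp_mul_fracIntegral hν₀ hc hrhs), laplace_const hc,
    laplace_fracIntegral hν₀ hc hrhs, laplace_add (hterm _ _) (hterm _ _), laplace_const_mul,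
    laplace_const_mul, Real.rpow_neg hc.le] at hlaplace
  have hcν : c ^ ν ≠ 0 := (Real.rpow_pos_of_pos hc ν).ne'
  field_simp at hlaplace ⊢
  linear_combination hlaplace

theorem mul_laplace_stateProb (h : IsFractionalBirthProcess μ ν rate Y) (hν₀ : 0 < ν)
    (hν₁ : ν ≤ 1) (hrate : ∀ r, 0 ≤ rate r) {c : ℝ} (hc : 0 < c) {n : ℕ} (hn : 1 ≤ n) :
    c * laplace (stateProb μ Y n) c = stoppedChainMass (fun r => rate r / c ^ ν) n := by
  have hpos : ∀ r, 1 + rate r / c ^ ν ≠ 0 := fun r => by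
    have := div_nonneg (hrate r) (Real.rpow_nonneg hc.le ν)
    positivity
  have hsucc := h.laplace_stateProb_succ hν₀ hν₁ hc
  induction n, hn using Nat.le_induction with
  | base =>
    have h₀ : laplace (stateProb μ Y 0) c = 0 := by
      rw [h.stateProb_zero, laplace_const hc, zero_div]
    rw [stoppedChainMass_one]
    refine eq_inv_of_mul_eq_one_right ?_
    simpa [h₀] using hsucc 0
  | succ n hn ih =>
    rw [stoppedChainMass_succ hn, eq_div_iff (hpos _), mul_comm, hsucc n, if_neg (by lia), ih,
      zero_add]

end IsFractionalBirthProcess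

end StateProb

/-! ### Creation times -/

section IndependentSeries

variable {Ω : Type*} [MeasurableSpace Ω] {μ : Measure Ω} {ξ : ℕ → Ω → ℝ}

theorem martingale_sum_range_of_iIndepFun [IsFiniteMeasure μ] (hm : ∀ i, StronglyMeasurable (ξ i))
    (hind : iIndepFun ξ μ) (hint : ∀ i, Integrable (ξ i) μ) (hmean : ∀ i, ∫ ω, ξ i ω ∂μ = 0) :
    Martingale (fun n => ∑ i ∈ Finset.range (n + 1), ξ i) (Filtration.natural ξ hm) μ := by
  set ℱ := Filtration.natural ξ hm
  have hadapted : StronglyAdapted ℱ fun n => ∑ i ∈ Finset.range (n + 1), ξ i := fun n =>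
    Finset.stronglyMeasurable_sum _ fun i hi =>
      (Filtration.stronglyAdapted_natural hm).stronglyMeasurable_le
        (Nat.lt_succ_iff.1 (Finset.mem_range.1 hi))
  have hsum : ∀ n, Integrable (∑ i ∈ Finset.range (n + 1), ξ i) μ :=
    fun n => integrable_finsetSum' _ fun i _ => hint i
  refine martingale_nat hadapted hsum fun n => ?_
  rw [Finset.sum_range_succ _ (n + 1)]
  filter_upwards [condExp_add (hsum n) (hint (n + 1)) (ℱ n),
    hind.condExp_natural_ae_eq_of_lt hm n.lt_succ_self] with ω hadd hnew
  rw [hadd, Pi.add_apply, hnew, hmean, add_zero,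
    condExp_of_stronglyMeasurable (ℱ.le n) (hadapted n) (hsum n)]

theorem integral_norm_le_one_add_variance [IsProbabilityMeasure μ] {Z : Ω → ℝ} (hZ : MemLp Z 2 μ)
    (hmean : ∫ ω, Z ω ∂μ = 0) : ∫ ω, ‖Z ω‖ ∂μ ≤ 1 + variance Z μ :=
  calc ∫ ω, ‖Z ω‖ ∂μ
      ≤ ∫ ω, (1 + Z ω ^ 2) ∂μ := by
        refine integral_mono (hZ.integrable one_le_two).norm
          ((integrable_const _).add hZ.integrable_sq) fun ω => ?_
        rw [Real.norm_eq_abs, ← sq_abs]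
        nlinarith [sq_nonneg (|Z ω| - 1)]
    _ = 1 + variance Z μ := by
        rw [integral_add (integrable_const _) hZ.integrable_sq,
          variance_of_integral_eq_zero hZ.aemeasurable hmean]
        simp

theorem ae_exists_tendsto_sum_range_of_summable_variance
    (hm : ∀ i, StronglyMeasurable (ξ i)) (hind : iIndepFun ξ μ) (hL2 : ∀ i, MemLp (ξ i) 2 μ)
    (hmean : ∀ i, ∫ ω, ξ i ω ∂μ = 0) (hvar : Summable fun i => variance (ξ i) μ) :
    ∀ᵐ ω ∂μ, ∃ c, Tendsto (fun n => ∑ i ∈ Finset.range n, ξ i ω) atTop (𝓝 c) := by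
  have : IsProbabilityMeasure μ := hind.isProbabilityMeasure
  have hint : ∀ i, Integrable (ξ i) μ := fun i => (hL2 i).integrable one_le_two
  have hbdd : ∀ n, eLpNorm (∑ i ∈ Finset.range (n + 1), ξ i) 1 μ
      ≤ (1 + ∑' i, variance (ξ i) μ).toNNReal := fun n => by
    have hS : MemLp (∑ i ∈ Finset.range (n + 1), ξ i) 2 μ := memLp_finsetSum' _ fun i _ => hL2 i
    have hSmean : ∫ ω, (∑ i ∈ Finset.range (n + 1), ξ i) ω ∂μ = 0 := by
      simp only [Finset.sum_apply]
      rw [integral_finsetSum _ fun i _ => hint i]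
      simp [hmean]
    have hSvar : variance (∑ i ∈ Finset.range (n + 1), ξ i) μ ≤ ∑' i, variance (ξ i) μ := by
      rw [IndepFun.variance_sum (fun i _ => hL2 i) fun i _ j _ hij => hind.indepFun hij]
      exact hvar.sum_le_tsum _ fun i _ => variance_nonneg _ _
    rw [eLpNorm_one_eq_lintegral_enorm,
      ← ofReal_integral_norm_eq_lintegral_enorm (hS.integrable one_le_two)]
    exact ENNReal.ofReal_le_ofReal
      ((integral_norm_le_one_add_variance hS hSmean).trans (by gcongr))
  have hmart := martingale_sum_range_of_iIndepFun hm hind hint hmean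
  filter_upwards [hmart.submartingale.exists_ae_tendsto_of_bdd hbdd] with ω ⟨c, hc⟩
  exact ⟨c, (tendsto_add_atTop_iff_nat 1).1 (by simpa only [Finset.sum_apply] using hc)⟩

end IndependentSeries

section ExponentialLaw

open Set

variable {r : ℝ}

theorem expMeasure_eq_withDensity_restrict (r : ℝ) :
    expMeasure r = (volume.restrict (Ioi 0)).withDensity
      fun x => ENNReal.ofReal (r * Real.exp (-(r * x))) := by
  rw [expMeasure, gammaMeasure, ← withDensity_indicator measurableSet_Ioi]
  refine withDensity_congr_ae ?_
  filter_upwards [Measure.ae_ne volume 0] with x hx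
  rcases lt_or_gt_of_ne hx with hx | hx
  · rw [gammaPDF_of_neg hx, indicator_of_notMem (by simpa using hx.le)]
  · rw [gammaPDF_of_nonneg hx.le, indicator_of_mem (by simpa using hx)]
    simp

theorem ae_nonneg_expMeasure (r : ℝ) : ∀ᵐ x ∂(expMeasure r), 0 ≤ x := by
  rw [expMeasure_eq_withDensity_restrict]
  refine withDensity_absolutelyContinuous _ _ ((ae_restrict_iff' measurableSet_Ioi).2 ?_)
  exact ae_of_all _ fun x hx => le_of_lt hx

theorem integral_pow_expMeasure (hr : 0 < r) (k : ℕ) :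
    ∫ x, x ^ k ∂(expMeasure r) = k.factorial / r ^ k := by
  rw [expMeasure_eq_withDensity_restrict, integral_withDensity_eq_integral_toReal_smul
    (by fun_prop) (ae_of_all _ fun _ => ENNReal.ofReal_lt_top)]
  calc ∫ x in Ioi 0, (ENNReal.ofReal (r * Real.exp (-(r * x)))).toReal • x ^ k
      = r * ∫ x in Ioi 0, x ^ ((k + 1 : ℝ) - 1) * Real.exp (-(r * x)) := by
        rw [← integral_const_mul]
        refine setIntegral_congr_fun measurableSet_Ioi fun x _ => ?_
        simp only [ENNReal.toReal_ofReal (mul_nonneg hr.le (Real.exp_pos _).le),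
          add_sub_cancel_right, Real.rpow_natCast, smul_eq_mul]
        ring
    _ = k.factorial / r ^ k := by
        rw [Real.integral_rpow_mul_exp_neg_mul_Ioi (by positivity) hr,
          Real.Gamma_nat_eq_factorial, ← Nat.cast_succ, Real.rpow_natCast, one_div, inv_pow,
          pow_succ]
        field_simp

theorem memLp_id_expMeasure (hr : 0 < r) : MemLp id 2 (expMeasure r) :=
  (memLp_two_iff_integrable_sq aestronglyMeasurable_id).2 <| .of_integral_ne_zero <| by
    simp only [id, integral_pow_expMeasure hr]
    positivity

theorem variance_id_expMeasure (hr : 0 < r) : variance id (expMeasure r) = (r ^ 2)⁻¹ := by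
  have := isProbabilityMeasure_expMeasure hr
  have h₁ := integral_pow_expMeasure hr 1
  have h₂ := integral_pow_expMeasure hr 2
  simp only [pow_one] at h₁
  rw [variance_eq_sub (memLp_id_expMeasure hr)]
  simp only [Pi.pow_apply, id, h₁, h₂]
  norm_num [Nat.factorial]
  field_simp
  norm_num

end ExponentialLaw

section BirthTime

variable {Ω : Type*} [MeasurableSpace Ω] {μ : Measure Ω} {β ν : ℝ} {rate : ℕ → ℝ}
  {gap : ℕ → Ω → ℝ} {X : ℕ → ℝ≥0 → Ω → ℕ} {pick : ℝ → Ω → ℕ}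

namespace IsGeneralizedYuleModel

theorem hasLaw_gap (h : IsGeneralizedYuleModel μ β ν rate gap X pick) (i : ℕ) :
    HasLaw (gap i) (expMeasure (β * (i + 1))) μ :=
  ⟨(h.gap_measurable i).aemeasurable, h.gap_law i⟩

theorem ae_monotone_birthTime (h : IsGeneralizedYuleModel μ β ν rate gap X pick) :
    ∀ᵐ ω ∂μ, Monotone fun k => birthTime gap k ω := by
  have hgap : ∀ᵐ ω ∂μ, ∀ i, 0 ≤ gap i ω := ae_all_iff.2 fun i =>
    ((h.hasLaw_gap i).ae_iff (by fun_prop)).2 (ae_nonneg_expMeasure _)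
  filter_upwards [hgap] with ω hω
  exact monotone_nat_of_le_succ fun k => by simp [birthTime, Finset.sum_range_succ, hω k]

theorem ae_exists_tendsto_birthTime_sub_harmonic
    (h : IsGeneralizedYuleModel μ β ν rate gap X pick) (hβ : 0 < β) :
    ∀ᵐ ω ∂μ, ∃ c, Tendsto (fun k : ℕ => birthTime gap k ω - harmonic k / β) atTop (𝓝 c) := by
  have : IsProbabilityMeasure μ := h.gap_indep.isProbabilityMeasure
  have hr : ∀ i : ℕ, 0 < β * (i + 1) := fun i => by positivity
  have hL2 : ∀ i, MemLp (gap i) 2 μ := fun i => by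
    have := memLp_id_expMeasure (hr i)
    rwa [← h.gap_law i, memLp_map_measure_iff aestronglyMeasurable_id
      (h.gap_measurable i).aemeasurable] at this
  have hmean : ∀ i, ∫ ω, gap i ω ∂μ = (β * (i + 1))⁻¹ := fun i => by
    rw [(h.hasLaw_gap i).integral_eq]
    simpa using integral_pow_expMeasure (hr i) 1
  have hvar : ∀ i, variance (fun ω => gap i ω - (β * (i + 1))⁻¹) μ = ((β * (i + 1)) ^ 2)⁻¹ :=
    fun i => by
      rw [variance_sub_const (h.gap_measurable i).aestronglyMeasurable,
        (h.hasLaw_gap i).variance_eq, variance_id_expMeasure (hr i)]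
  have hconv := ae_exists_tendsto_sum_range_of_summable_variance (μ := μ)
    (ξ := fun i ω => gap i ω - (β * (i + 1))⁻¹)
    (fun i => ((h.gap_measurable i).sub_const _).stronglyMeasurable)
    (h.gap_indep.comp (fun i x => x - (β * (i + 1))⁻¹) fun i => by fun_prop)
    (fun i => (hL2 i).sub (memLp_const _))
    (fun i => by
      rw [integral_sub ((hL2 i).integrable one_le_two) (integrable_const _), hmean]
      simp)
    (by
      refine (((summable_nat_add_iff 1).2 (Real.summable_nat_pow_inv.2 one_lt_two)).mul_left
        (β ^ 2)⁻¹).congr fun i => ?_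
      rw [hvar, mul_pow, mul_inv, Nat.cast_succ])
  filter_upwards [hconv] with ω ⟨c, hc⟩
  refine ⟨c, hc.congr fun k => ?_⟩
  simp [birthTime, harmonic, Finset.sum_sub_distrib, Finset.sum_mul, div_eq_mul_inv]

theorem ae_exists_tendsto_birthTime_sub_log
    (h : IsGeneralizedYuleModel μ β ν rate gap X pick) (hβ : 0 < β) :
    ∀ᵐ ω ∂μ, ∃ c, Tendsto (fun k : ℕ => birthTime gap k ω - Real.log k / β) atTop (𝓝 c) := by
  filter_upwards [h.ae_exists_tendsto_birthTime_sub_harmonic hβ] with ω ⟨c, hc⟩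
  refine ⟨c + Real.eulerMascheroniConstant / β,
    (hc.add (Real.tendsto_harmonic_sub_log.div_const β)).congr fun k => ?_⟩
  ring

end IsGeneralizedYuleModel

end BirthTime

/-! ### Ages of the pages -/

section UnitInterval

open Set

theorem integral_comp_natFloor_eq_sum_range (g : ℕ → ℝ) (n : ℕ) :
    ∫ y in (0 : ℝ)..n, g ⌊y⌋₊ = ∑ k ∈ Finset.range n, g k := by
  have hstep : ∀ k : ℕ, ∀ᵐ y : ℝ, y ∈ uIoc (k : ℝ) ((k + 1 : ℕ) : ℝ) → g k = g ⌊y⌋₊ := by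
    intro k
    filter_upwards [Measure.ae_ne volume ((k + 1 : ℕ) : ℝ)] with y hy hyk
    rw [uIoc_of_le (by simp)] at hyk
    rw [(Nat.floor_eq_iff (k.cast_nonneg.trans hyk.1.le)).2
      ⟨hyk.1.le, by exact_mod_cast hyk.2.lt_of_ne hy⟩]
  have h := intervalIntegral.sum_integral_adjacent_intervals (μ := volume)
    (f := fun y : ℝ => g ⌊y⌋₊) (a := fun k : ℕ => (k : ℝ)) (n := n) fun k _ =>
      (intervalIntegrable_const (c := g k)).congr_ae
        ((ae_restrict_iff' measurableSet_uIoc).2 (hstep k))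
  rw [Nat.cast_zero] at h
  rw [← h]
  refine Finset.sum_congr rfl fun k _ => ?_
  rw [← intervalIntegral.integral_congr_ae (hstep k)]
  simp

theorem integral_comp_natFloor_mul_eq_average (g : ℕ → ℝ) {n : ℕ} (hn : n ≠ 0) :
    ∫ x in (0 : ℝ)..1, g ⌊(n : ℝ) * x⌋₊ = (n : ℝ)⁻¹ * ∑ k ∈ Finset.range n, g k := by
  rw [intervalIntegral.integral_comp_mul_left (fun y => g ⌊y⌋₊) (Nat.cast_ne_zero.2 hn),
    mul_zero, mul_one, integral_comp_natFloor_eq_sum_range, smul_eq_mul]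

theorem image_exp_neg_mul_Ioi {β : ℝ} (hβ : 0 < β) :
    (fun s : ℝ => Real.exp (-β * s)) '' Ioi 0 = Ioo 0 1 := by
  ext x
  constructor
  · rintro ⟨s, hs, rfl⟩
    exact ⟨Real.exp_pos _, Real.exp_lt_one_iff.2 (by simpa using mul_pos hβ hs)⟩
  · rintro ⟨hx₀, hx₁⟩
    refine ⟨-Real.log x / β, div_pos (neg_pos.2 (Real.log_neg hx₀ hx₁)) hβ, ?_⟩
    simp only [neg_mul, mul_div_cancel₀ _ hβ.ne', neg_neg, Real.exp_log hx₀]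

theorem integral_comp_neg_log_div {β : ℝ} (hβ : 0 < β) (p : ℝ → ℝ) :
    ∫ x in (0 : ℝ)..1, p (-Real.log x / β) = β * laplace p β := by
  have hderiv : ∀ s ∈ Ioi (0 : ℝ), HasDerivWithinAt (fun s : ℝ => Real.exp (-β * s))
      (Real.exp (-β * s) * -β) (Ioi 0) s := fun s _ => by
    simpa using ((hasDerivAt_id s).const_mul (-β)).exp.hasDerivWithinAt
  have hinj : InjOn (fun s : ℝ => Real.exp (-β * s)) (Ioi 0) := fun a _ b _ hab =>
    mul_left_cancel₀ (neg_ne_zero.2 hβ.ne') (Real.exp_injective hab)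
  have h := integral_image_eq_integral_abs_deriv_smul measurableSet_Ioi hderiv hinj
    (fun x => p (-Real.log x / β))
  rw [image_exp_neg_mul_Ioi hβ] at h
  rw [intervalIntegral.integral_of_le zero_le_one, integral_Ioc_eq_integral_Ioo, h, laplace,
    ← integral_const_mul]
  refine setIntegral_congr_fun measurableSet_Ioi fun s _ => ?_
  simp only [Real.log_exp, smul_eq_mul, abs_mul, Real.abs_exp, abs_neg, abs_of_pos hβ, neg_mul,
    neg_neg, mul_div_cancel_left₀ s hβ.ne']
  ring

end UnitInterval

/-- The average of `p` over the ages at time `t` of the pages present then, page `k` being created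
at time `T k`; meant for nondecreasing `T`, where the pages present are those of smallest index. -/
noncomputable def ageAverage (T : ℕ → ℝ) (p : ℝ → ℝ) (t : ℝ) : ℝ :=
  ({k : ℕ | T k ≤ t}.ncard : ℝ)⁻¹ * ∑ k ∈ Finset.range {k : ℕ | T k ≤ t}.ncard, p (t - T k)

section Ages

variable {T : ℕ → ℝ} {β c : ℝ}

theorem tendsto_atTop_of_tendsto_sub_log (hβ : 0 < β)
    (hT : Tendsto (fun k : ℕ => T k - Real.log k / β) atTop (𝓝 c)) : Tendsto T atTop atTop :=
  (hT.add_atTop ((Real.tendsto_log_atTop.comp tendsto_natCast_atTop_atTop).atTop_div_const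
    hβ)).congr fun _ => sub_add_cancel _ _

theorem lt_ncard_iff_le (hmono : Monotone T) (htop : Tendsto T atTop atTop) (t : ℝ) (k : ℕ) :
    k < {k : ℕ | T k ≤ t}.ncard ↔ T k ≤ t := by
  classical
  have hex : ∃ k, t < T k := (htop.eventually_gt_atTop t).exists
  have hset : {k : ℕ | T k ≤ t} = Set.Iio (Nat.find hex) := by
    ext k
    simp only [Set.mem_ofPred_eq, Set.mem_Iio, Nat.lt_find_iff, not_lt]
    exact ⟨fun h m hm => (hmono hm).trans h, fun h => h k le_rfl⟩
  have hcard : {k : ℕ | T k ≤ t}.ncard = Nat.find hex := by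
    rw [hset, ← Finset.coe_Iio, Set.ncard_coe_finset, Nat.card_Iio]
  rw [hcard, ← Set.mem_Iio, ← hset, Set.mem_ofPred_eq]

theorem tendsto_ncard_atTop (hmono : Monotone T) (htop : Tendsto T atTop atTop) :
    Tendsto (fun t : ℝ => {k : ℕ | T k ≤ t}.ncard) atTop atTop := by
  refine tendsto_atTop.2 fun m => ?_
  filter_upwards [eventually_ge_atTop (T m)] with t ht
  exact ((lt_ncard_iff_le hmono htop t m).2 ht).le

theorem tendsto_sub_log_ncard (hmono : Monotone T) (hβ : 0 < β)
    (hT : Tendsto (fun k : ℕ => T k - Real.log k / β) atTop (𝓝 c)) :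
    Tendsto (fun t : ℝ => t - Real.log ({k : ℕ | T k ≤ t}.ncard : ℝ) / β) atTop (𝓝 c) := by
  have htop := tendsto_atTop_of_tendsto_sub_log hβ hT
  have hcount := tendsto_ncard_atTop hmono htop
  have hT' : Tendsto (fun n : ℕ => T (n - 1) - Real.log n / β) atTop (𝓝 c) := by
    rw [← tendsto_add_atTop_iff_nat 1]
    have h := hT.sub (Real.tendsto_log_nat_add_one_sub_log.div_const β)
    rw [zero_div, sub_zero] at h
    refine h.congr fun n => ?_
    simp only [add_tsub_cancel_right, Nat.cast_succ]
    ring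
  refine tendsto_of_tendsto_of_tendsto_of_le_of_le' (hT'.comp hcount) (hT.comp hcount) ?_ ?_
  · filter_upwards [hcount.eventually_ge_atTop 1] with t ht
    have hlast := (lt_ncard_iff_le hmono htop t ({k : ℕ | T k ≤ t}.ncard - 1)).1 (by lia)
    simpa only [Function.comp] using sub_le_sub_right hlast _
  · refine Eventually.of_forall fun t => ?_
    have hnext := (lt_ncard_iff_le hmono htop t {k : ℕ | T k ≤ t}.ncard).not.1 (lt_irrefl _)
    simpa only [Function.comp] using sub_le_sub_right (not_le.1 hnext).le _

theorem tendsto_sub_natFloor_ncard_mul (hmono : Monotone T) (hβ : 0 < β)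
    (hT : Tendsto (fun k : ℕ => T k - Real.log k / β) atTop (𝓝 c)) {x : ℝ} (hx : 0 < x) :
    Tendsto (fun t : ℝ => t - T ⌊({k : ℕ | T k ≤ t}.ncard : ℝ) * x⌋₊) atTop
      (𝓝 (-Real.log x / β)) := by
  set n : ℝ → ℕ := fun t => {k : ℕ | T k ≤ t}.ncard
  have hn : Tendsto n atTop atTop :=
    tendsto_ncard_atTop hmono (tendsto_atTop_of_tendsto_sub_log hβ hT)
  have hn' : Tendsto (fun t => (n t : ℝ)) atTop atTop := tendsto_natCast_atTop_atTop.comp hn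
  have hfloor : Tendsto (fun t => ⌊(n t : ℝ) * x⌋₊) atTop atTop :=
    tendsto_nat_floor_atTop.comp (hn'.atTop_mul_const hx)
  have hratio : Tendsto (fun t => (⌊(n t : ℝ) * x⌋₊ : ℝ) / n t) atTop (𝓝 x) := by
    simpa only [Function.comp_def, mul_comm x] using
      (tendsto_nat_floor_mul_div_atTop (R := ℝ) hx.le).comp hn'
  have h := ((tendsto_sub_log_ncard hmono hβ hT).sub (hT.comp hfloor)).sub
    ((hratio.log hx.ne').div_const β)
  rw [sub_self, zero_sub, ← neg_div] at h
  refine h.congr' ?_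
  filter_upwards [hn.eventually_gt_atTop 0, hfloor.eventually_gt_atTop 0] with t hnt hft
  simp only [Function.comp]
  rw [Real.log_div (by positivity) (by positivity)]
  ring

theorem tendsto_ageAverage (hmono : Monotone T) (hβ : 0 < β)
    (hT : Tendsto (fun k : ℕ => T k - Real.log k / β) atTop (𝓝 c)) {p : ℝ → ℝ}
    (hp : Continuous p) {M : ℝ} (hM : ∀ s, |p s| ≤ M) :
    Tendsto (ageAverage T p) atTop (𝓝 (β * laplace p β)) := by
  have hDCT : Tendsto (fun t : ℝ => ∫ x in (0 : ℝ)..1,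
      p (t - T ⌊({k : ℕ | T k ≤ t}.ncard : ℝ) * x⌋₊)) atTop (𝓝 (β * laplace p β)) := by
    rw [← integral_comp_neg_log_div hβ]
    refine intervalIntegral.tendsto_integral_filter_of_dominated_convergence (fun _ => M)
      (Eventually.of_forall fun t => ?_) (Eventually.of_forall fun t => ae_of_all _ fun x _ => hM _)
      intervalIntegrable_const (ae_of_all _ fun x hx => ?_)
    · have hm : Measurable fun k : ℕ => p (t - T k) := measurable_from_nat
      exact (hm.comp (Nat.measurable_floor.comp (measurable_const_mul _))).aestronglyMeasurable
    · rw [Set.uIoc_of_le zero_le_one] at hx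
      exact (hp.tendsto _).comp (tendsto_sub_natFloor_ncard_mul hmono hβ hT hx.1)
  refine hDCT.congr' ?_
  have hcount := tendsto_ncard_atTop hmono (tendsto_atTop_of_tendsto_sub_log hβ hT)
  filter_upwards [hcount.eventually_gt_atTop 0] with t ht
  exact integral_comp_natFloor_mul_eq_average (fun k => p (t - T k)) ht.ne'

theorem abs_ageAverage_le {p : ℝ → ℝ} {M : ℝ} (hM : ∀ s, |p s| ≤ M) (t : ℝ) :
    |ageAverage T p t| ≤ M := by
  have hM₀ : 0 ≤ M := (abs_nonneg _).trans (hM 0)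
  rw [ageAverage, abs_mul, abs_of_nonneg (by positivity)]
  refine inv_mul_le_of_le_mul₀ (Nat.cast_nonneg _) hM₀ ?_
  exact (Finset.abs_sum_le_sum_abs _ _).trans
    ((Finset.sum_le_card_nsmul _ _ M fun k _ => hM _).trans_eq (by simp))

end Ages

/-! ### Uniform choice of a page -/

section PageWeight

variable {T : ℕ → ℝ} {p : ℝ → ℝ} {t : ℝ} {k : ℕ}

/-- The probability of choosing page `k` when a page is chosen uniformly at random among those
present at time `t`, given the creation times `T`. -/
noncomputable def pageWeight (T : ℕ → ℝ) (t : ℝ) (k : ℕ) : ℝ :=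
  if T k ≤ t then ({k : ℕ | T k ≤ t}.ncard : ℝ)⁻¹ else 0

theorem pageWeight_nonneg (T : ℕ → ℝ) (t : ℝ) (k : ℕ) : 0 ≤ pageWeight T t k := by
  unfold pageWeight
  positivity

theorem pageWeight_le_one (T : ℕ → ℝ) (t : ℝ) (k : ℕ) : pageWeight T t k ≤ 1 := by
  unfold pageWeight
  split_ifs
  · exact Nat.cast_inv_le_one _
  · exact zero_le_one

theorem tsum_mul_pageWeight (hmono : Monotone T) (htop : Tendsto T atTop atTop) (p : ℝ → ℝ)
    (t : ℝ) : ∑' k, p (t - T k) * pageWeight T t k = ageAverage T p t := by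
  have hiff := lt_ncard_iff_le hmono htop t
  rw [tsum_eq_sum (s := Finset.range {k : ℕ | T k ≤ t}.ncard) fun k hk => ?_, ageAverage,
    Finset.mul_sum]
  · refine Finset.sum_congr rfl fun k hk => ?_
    rw [pageWeight, if_pos ((hiff k).1 (Finset.mem_range.1 hk)), mul_comm]
  · rw [pageWeight, if_neg fun hle => hk (Finset.mem_range.2 ((hiff k).2 hle)), mul_zero]

theorem measurable_ncard_le (t : ℝ) : Measurable fun T : ℕ → ℝ => {k : ℕ | T k ≤ t}.ncard :=
  measurable_ncard.comp <| measurable_set_iff.2 fun k =>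
    measurableSet_setOfPred.1 <| measurableSet_le (measurable_pi_apply k) measurable_const

theorem measurable_pageWeight (t : ℝ) (k : ℕ) : Measurable fun T => pageWeight T t k :=
  Measurable.ite (measurableSet_le (measurable_pi_apply k) measurable_const)
    ((measurable_from_nat (f := fun n : ℕ => (n : ℝ))).comp (measurable_ncard_le t)).inv
    measurable_const

theorem integrable_pageWeight {μ : Measure (ℕ → ℝ)} [IsFiniteMeasure μ] (t : ℝ) (k : ℕ) :
    Integrable (fun T => pageWeight T t k) μ :=
  .of_bound (measurable_pageWeight t k).aestronglyMeasurable 1 <| ae_of_all _ fun T => by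
    rw [Real.norm_of_nonneg (pageWeight_nonneg T t k)]
    exact pageWeight_le_one T t k

theorem measurable_ageAverage (hp : Measurable p) (t : ℝ) :
    Measurable fun T => ageAverage T p t := by
  have h : Measurable fun q : ℕ × (ℕ → ℝ) =>
      (q.1 : ℝ)⁻¹ * ∑ k ∈ Finset.range q.1, p (t - q.2 k) :=
    measurable_from_prod_countable_right fun n => by dsimp only; fun_prop
  exact h.comp ((measurable_ncard_le t).prodMk measurable_id)

end PageWeight

section RightContinuous

/-- The right-continuous paths of natural numbers. They carry the `σ`-algebra of the coordinates,
for which evaluation is jointly measurable. -/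
abbrev RightContinuousPath : Type :=
  {y : ℝ≥0 → ℕ // ∀ t, ContinuousWithinAt y (Set.Ici t) t}

theorem tendsto_natFloor_mul_add_one_div (t : ℝ≥0) :
    Tendsto (fun j : ℕ => ((⌊((j : ℝ≥0) + 1) * t⌋₊ : ℝ≥0) + 1) / ((j : ℝ≥0) + 1)) atTop
      (𝓝[≥] t) := by
  have hge : ∀ j : ℕ, t ≤ ((⌊((j : ℝ≥0) + 1) * t⌋₊ : ℝ≥0) + 1) / ((j : ℝ≥0) + 1) := fun j => by
    rw [le_div_iff₀ (by positivity), mul_comm]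
    exact (Nat.lt_floor_add_one _).le
  have hle : ∀ j : ℕ, ((⌊((j : ℝ≥0) + 1) * t⌋₊ : ℝ≥0) + 1) / ((j : ℝ≥0) + 1)
      ≤ t + 1 / ((j : ℝ≥0) + 1) := fun j => by
    rw [add_div]
    gcongr
    rw [div_le_iff₀ (by positivity), mul_comm t]
    exact Nat.floor_le zero_le
  have hlim : Tendsto (fun j : ℕ => t + 1 / ((j : ℝ≥0) + 1)) atTop (𝓝 t) := by
    simpa only [add_zero] using
      (tendsto_const_nhds (x := t)).add tendsto_one_div_add_atTop_nhds_zero_nat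
  exact tendsto_nhdsWithin_iff.2
    ⟨tendsto_of_tendsto_of_tendsto_of_le_of_le tendsto_const_nhds hlim hge hle, .of_forall hge⟩

theorem measurable_uncurry_of_rightContinuous {α E : Type*} [MeasurableSpace α]
    [TopologicalSpace E] [TopologicalSpace.PseudoMetrizableSpace E] [MeasurableSpace E]
    [BorelSpace E] {Y : ℝ≥0 → α → E} (hY : ∀ t, Measurable (Y t))
    (hright : ∀ x t, ContinuousWithinAt (fun s => Y s x) (Set.Ici t) t) :
    Measurable (Function.uncurry Y) := by
  let approx (j : ℕ) (z : ℝ≥0 × α) : E :=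
    Y (((⌊((j : ℝ≥0) + 1) * z.1⌋₊ : ℝ≥0) + 1) / ((j : ℝ≥0) + 1)) z.2
  have happrox : ∀ j, Measurable (approx j) := fun j => by
    have hgrid : Measurable fun q : ℕ × α => Y (((q.1 : ℝ≥0) + 1) / ((j : ℝ≥0) + 1)) q.2 :=
      measurable_from_prod_countable_right fun k => hY ((k + 1) / (j + 1))
    have hfloor : Measurable fun z : ℝ≥0 × α => (⌊((j : ℝ≥0) + 1) * z.1⌋₊, z.2) :=
      (Nat.measurable_floor.comp (measurable_fst.const_mul _)).prodMk measurable_snd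
    simpa only [Function.comp_def] using hgrid.comp hfloor
  exact measurable_of_tendsto_metrizable happrox <| tendsto_pi_nhds.2 fun z =>
    (hright z.2 z.1).tendsto.comp (tendsto_natFloor_mul_add_one_div z.1)

theorem measurable_eval_rightContinuousPath :
    Measurable fun z : ℝ≥0 × RightContinuousPath => z.2.1 z.1 :=
  measurable_uncurry_of_rightContinuous (Y := fun t (y : RightContinuousPath) => y.1 t)
    (fun t => (measurable_pi_apply t).comp measurable_subtype_coe) fun y => y.2

end RightContinuous

section Independence

variable {Ω E F : Type*} {mΩ : MeasurableSpace Ω} [MeasurableSpace E] [MeasurableSpace F]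
  {μ : Measure Ω}

theorem setIntegral_comp_of_indepFun [IsFiniteMeasure μ] {G : Ω → E} {H : Ω → F}
    (hG : Measurable G) (hH : Measurable H) (hind : IndepFun G H μ) {s : Set (E × F)}
    (hs : MeasurableSet s) {w : E → ℝ} (hw : Integrable w (μ.map G)) :
    ∫ ω in {ω | (G ω, H ω) ∈ s}, w (G ω) ∂μ
      = ∫ ω, μ.real {ω' | (G ω, H ω') ∈ s} * w (G ω) ∂μ := by
  have hjoint := hind.map_prod_eq_prod_map_map hG.aemeasurable hH.aemeasurable
  have hws : Integrable (s.indicator fun z => w z.1) ((μ.map G).prod (μ.map H)) :=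
    (hw.comp_fst _).indicator hs
  have hsection : ∀ x, ∫ y, s.indicator (fun z => w z.1) (x, y) ∂(μ.map H)
      = μ.real {ω' | (x, H ω') ∈ s} * w x := fun x => by
    have hsx : MeasurableSet (Prod.mk x ⁻¹' s) := measurable_prodMk_left hs
    rw [← smul_eq_mul, show μ.real {ω' | (x, H ω') ∈ s} = (μ.map H).real (Prod.mk x ⁻¹' s) from
      (map_measureReal_apply hH hsx).symm, ← integral_indicator_const _ hsx]
    rfl
  calc ∫ ω in {ω | (G ω, H ω) ∈ s}, w (G ω) ∂μ
      = ∫ z in s, w z.1 ∂(μ.map fun ω => (G ω, H ω)) :=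
        (setIntegral_map hs (hjoint ▸ (hw.comp_fst _).aestronglyMeasurable)
          (hG.prodMk hH).aemeasurable).symm
    _ = ∫ x, μ.real {ω' | (x, H ω') ∈ s} * w x ∂(μ.map G) := by
        rw [hjoint, ← integral_indicator hs, integral_prod _ hws]
        simp only [hsection]
    _ = ∫ ω, μ.real {ω' | (G ω, H ω') ∈ s} * w (G ω) ∂μ := by
        refine integral_map hG.aemeasurable ?_
        simpa only [hsection] using hws.integral_prod_left.aestronglyMeasurable

theorem hasSum_measureReal_inter_fiber [IsFiniteMeasure μ] [Countable E]
    [MeasurableSingletonClass E] {Z : Ω → E} (hZ : Measurable Z) (s : Set Ω) :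
    HasSum (fun k => μ.real (s ∩ {ω | Z ω = k})) (μ.real s) := by
  have hfiber : ∀ k, MeasurableSet {ω | Z ω = k} := fun k => hZ (measurableSet_singleton k)
  have htsum : ∑' k, μ (s ∩ {ω | Z ω = k}) = μ s := by
    have h := tsum_measure_preimage_singleton (μ := μ.restrict s) Set.countable_univ
      fun k _ => hfiber k
    rw [tsum_univ fun k => μ.restrict s (Z ⁻¹' {k}), Set.preimage_univ,
      Measure.restrict_apply_univ] at h
    rw [← h]
    refine tsum_congr fun k => ?_
    rw [Set.inter_comm]
    exact (Measure.restrict_apply (hfiber k)).symm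
  have h := ENNReal.hasSum_toReal (htsum.trans_ne (measure_ne_top μ s))
  rwa [← ENNReal.tsum_toReal_eq fun k => measure_ne_top _ _, htsum] at h

end Independence

/-! ### Limit law -/

theorem measurable_birthTimes {Ω : Type*} {_ : MeasurableSpace Ω} {gap : ℕ → Ω → ℝ}
    (hgap : ∀ i, Measurable (gap i)) : Measurable fun ω k => birthTime gap k ω :=
  measurable_pi_lambda _ fun _ => Finset.measurable_fun_sum _ fun i _ => hgap i

section UniformPage

variable {Ω : Type*} [MeasurableSpace Ω] {μ : Measure Ω} {β ν lam t : ℝ} {rate : ℕ → ℝ}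
  {gap : ℕ → Ω → ℝ} {X : ℕ → ℝ≥0 → Ω → ℕ} {pick : ℝ → Ω → ℕ}

/-- The in-link process of a page as a random right-continuous path. -/
def IsFractionalBirthProcess.path {Y : ℝ≥0 → Ω → ℕ} (h : IsFractionalBirthProcess μ ν rate Y)
    (ω : Ω) : RightContinuousPath :=
  ⟨fun s => Y s ω, h.rightCont ω⟩

/-- The pairs of creation times and in-link path for which page `k` has size `n` at time `t`. -/
def sizeEvent (t : ℝ) (k n : ℕ) : Set ((ℕ → ℝ) × RightContinuousPath) :=
  {z | z.2.1 (t - z.1 k).toNNReal = n}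

theorem measurableSet_sizeEvent (t : ℝ) (k n : ℕ) : MeasurableSet (sizeEvent t k n) := by
  have hage : Measurable fun z : (ℕ → ℝ) × RightContinuousPath => (t - z.1 k).toNNReal :=
    (measurable_const.sub ((measurable_pi_apply k).comp measurable_fst)).real_toNNReal
  exact (measurable_eval_rightContinuousPath.comp (hage.prodMk measurable_snd))
    (measurableSet_singleton n)

namespace IsGeneralizedYuleModel

theorem measurableSet_size_eq (h : IsGeneralizedYuleModel μ β ν rate gap X pick) (t : ℝ)
    (k n : ℕ) :
    MeasurableSet[networkSigma gap X] {ω | X k (t - birthTime gap k ω).toNNReal ω = n} := by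
  have hnetwork := comap_measurable (m := inferInstance)
    (fun ω => ((fun i => gap i ω, fun i s => X i s ω) : (ℕ → ℝ) × (ℕ → ℝ≥0 → ℕ)))
  have hgap : ∀ i, Measurable[networkSigma gap X] (gap i) := fun i =>
    (measurable_pi_apply i).comp (measurable_fst.comp hnetwork)
  have hpath : Measurable[networkSigma gap X] (h.inlinks k).path :=
    ((measurable_pi_apply k).comp (measurable_snd.comp hnetwork)).subtype_mk
  exact ((measurable_birthTimes hgap).prodMk hpath) (measurableSet_sizeEvent t k n)

theorem indepFun_birthTimes_path (h : IsGeneralizedYuleModel μ β ν rate gap X pick) (k : ℕ) :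
    IndepFun (fun ω j => birthTime gap j ω) (h.inlinks k).path μ := by
  have hind : IndepFun (fun ω j => birthTime gap j ω) (fun ω s => X k s ω) μ :=
    h.gap_inlinks_indep.comp (measurable_birthTimes fun i => measurable_pi_apply i)
      (measurable_pi_apply k)
  rw [IndepFun_iff_Indep] at hind ⊢
  convert hind using 1
  exact MeasurableSpace.comap_comp

theorem setIntegral_pageWeight (h : IsGeneralizedYuleModel μ β ν rate gap X pick) (t : ℝ)
    (k n : ℕ) :
    ∫ ω in {ω | X k (t - birthTime gap k ω).toNNReal ω = n},
        pageWeight (fun j => birthTime gap j ω) t k ∂μ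
      = ∫ ω, stateProb μ (X k) n (t - birthTime gap k ω)
          * pageWeight (fun j => birthTime gap j ω) t k ∂μ := by
  have : IsProbabilityMeasure μ := h.gap_indep.isProbabilityMeasure
  have hpath : Measurable (h.inlinks k).path :=
    (measurable_pi_lambda _ (h.inlinks k).measurable).subtype_mk
  exact setIntegral_comp_of_indepFun (measurable_birthTimes h.gap_measurable) hpath
    (h.indepFun_birthTimes_path k) (measurableSet_sizeEvent t k n) (integrable_pageWeight t k)

theorem hasSum_measureReal_pageSize (h : IsGeneralizedYuleModel μ β ν rate gap X pick)
    (ht : 0 ≤ t) (n : ℕ) :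
    HasSum (fun k => ∫ ω, stateProb μ (X k) n (t - birthTime gap k ω)
        * pageWeight (fun j => birthTime gap j ω) t k ∂μ)
      (μ.real {ω | pageSize gap X pick t ω = n}) := by
  have : IsProbabilityMeasure μ := h.gap_indep.isProbabilityMeasure
  refine (hasSum_measureReal_inter_fiber (h.pick_measurable t) _).congr_fun fun k => ?_
  have hsize : {ω | pageSize gap X pick t ω = n} ∩ {ω | pick t ω = k}
      = {ω | X k (t - birthTime gap k ω).toNNReal ω = n} ∩ {ω | pick t ω = k} := by
    ext ω
    simp only [Set.mem_inter_iff, Set.mem_ofPred_eq, pageSize]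
    constructor <;> rintro ⟨hn, rfl⟩ <;> exact ⟨hn, rfl⟩
  rw [← h.setIntegral_pageWeight, hsize]
  exact (h.pick_uniform t ht k _ (h.measurableSet_size_eq t k n)).symm

theorem integrable_pageWeight_birthTime (h : IsGeneralizedYuleModel μ β ν rate gap X pick)
    (t : ℝ) (k : ℕ) : Integrable (fun ω => pageWeight (fun j => birthTime gap j ω) t k) μ := by
  have : IsProbabilityMeasure μ := h.gap_indep.isProbabilityMeasure
  exact (integrable_pageWeight t k).comp_measurable (measurable_birthTimes h.gap_measurable)

theorem summable_integral_pageWeight (h : IsGeneralizedYuleModel μ β ν rate gap X pick)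
    (ht : 0 ≤ t) : Summable fun k => ∫ ω, pageWeight (fun j => birthTime gap j ω) t k ∂μ := by
  have : IsProbabilityMeasure μ := h.gap_indep.isProbabilityMeasure
  refine (hasSum_measureReal_inter_fiber (μ := μ) (h.pick_measurable t) Set.univ).summable.congr
    fun k => ?_
  rw [h.pick_uniform t ht k _ MeasurableSet.univ, Measure.restrict_univ]
  rfl

theorem hasSum_integral_mul_pageWeight (h : IsGeneralizedYuleModel μ β ν rate gap X pick)
    (ht : 0 ≤ t) {p : ℝ → ℝ} (hp : Measurable p) {M : ℝ} (hM : ∀ s, |p s| ≤ M) :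
    HasSum (fun k => ∫ ω, p (t - birthTime gap k ω)
        * pageWeight (fun j => birthTime gap j ω) t k ∂μ)
      (∫ ω, ∑' k, p (t - birthTime gap k ω) * pageWeight (fun j => birthTime gap j ω) t k ∂μ) := by
  have hint : ∀ k, Integrable (fun ω => p (t - birthTime gap k ω)
      * pageWeight (fun j => birthTime gap j ω) t k) μ := fun k =>
    (h.integrable_pageWeight_birthTime t k).bdd_mul (c := M)
      (hp.comp (measurable_const.sub ((measurable_pi_apply k).comp
        (measurable_birthTimes h.gap_measurable)))).aestronglyMeasurable
      (ae_of_all _ fun ω => hM _)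
  refine hasSum_integral_of_summable_integral_norm hint ?_
  refine .of_nonneg_of_le (fun k => integral_nonneg fun ω => norm_nonneg _) (fun k => ?_)
    ((h.summable_integral_pageWeight ht).mul_left M)
  rw [← integral_const_mul]
  refine integral_mono (hint k).norm ((h.integrable_pageWeight_birthTime t k).const_mul M)
    fun ω => ?_
  rw [norm_mul, Real.norm_of_nonneg (pageWeight_nonneg _ t k)]
  exact mul_le_mul_of_nonneg_right (hM _) (pageWeight_nonneg _ t k)

theorem measureReal_pageSize_eq (h : IsGeneralizedYuleModel μ β ν rate gap X pick) (hβ : 0 < β)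
    (hν₀ : 0 < ν) (hν₁ : ν ≤ 1) (n : ℕ) (ht : 0 ≤ t) :
    μ.real {ω | pageSize gap X pick t ω = n}
      = ∫ ω, ageAverage (fun k => birthTime gap k ω) (stateProb μ (X 0) n) t ∂μ := by
  have : IsProbabilityMeasure μ := h.gap_indep.isProbabilityMeasure
  have hsum := h.hasSum_measureReal_pageSize ht n
  simp only [fun k => (h.inlinks k).stateProb_unique (h.inlinks 0) hν₀ hν₁ n] at hsum
  rw [hsum.unique (h.hasSum_integral_mul_pageWeight ht
    ((h.inlinks 0).continuous_stateProb n).measurable (abs_stateProb_le_one (X 0) n))]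
  refine integral_congr_ae ?_
  filter_upwards [h.ae_monotone_birthTime, h.ae_exists_tendsto_birthTime_sub_log hβ]
    with ω hmono ⟨c, hc⟩
  exact tsum_mul_pageWeight hmono (tendsto_atTop_of_tendsto_sub_log hβ hc) _ t

theorem tendsto_integral_ageAverage (h : IsGeneralizedYuleModel μ β ν rate gap X pick)
    (hβ : 0 < β) {p : ℝ → ℝ} (hp : Continuous p) {M : ℝ} (hM : ∀ s, |p s| ≤ M) :
    Tendsto (fun t => ∫ ω, ageAverage (fun k => birthTime gap k ω) p t ∂μ) atTop
      (𝓝 (β * laplace p β)) := by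
  have : IsProbabilityMeasure μ := h.gap_indep.isProbabilityMeasure
  have hconst : ∫ _, β * laplace p β ∂μ = β * laplace p β := by simp
  rw [← hconst]
  refine tendsto_integral_filter_of_dominated_convergence (fun _ => M)
    (.of_forall fun t => ?_) (.of_forall fun t => ae_of_all _ fun ω => abs_ageAverage_le hM t)
    (integrable_const _) ?_
  · exact ((measurable_ageAverage hp.measurable t).comp
      (measurable_birthTimes h.gap_measurable)).aestronglyMeasurable
  · filter_upwards [h.ae_monotone_birthTime, h.ae_exists_tendsto_birthTime_sub_log hβ]
      with ω hmono ⟨c, hc⟩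
    exact tendsto_ageAverage hmono hβ hc hp hM

theorem tendsto_measureReal_pageSize (h : IsGeneralizedYuleModel μ β ν rate gap X pick)
    (hβ : 0 < β) (hν₀ : 0 < ν) (hν₁ : ν ≤ 1) (hrate : ∀ r, 0 ≤ rate r) {n : ℕ} (hn : 1 ≤ n) :
    Tendsto (fun t : ℝ => μ.real {ω | pageSize gap X pick t ω = n}) atTop
      (𝓝 (stoppedChainMass (fun r => rate r / β ^ ν) n)) := by
  have : IsProbabilityMeasure μ := h.gap_indep.isProbabilityMeasure
  rw [← (h.inlinks 0).mul_laplace_stateProb hν₀ hν₁ hrate hβ hn]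
  refine (h.tendsto_integral_ageAverage hβ ((h.inlinks 0).continuous_stateProb n)
    (abs_stateProb_le_one (X 0) n)).congr' ?_
  filter_upwards [eventually_ge_atTop 0] with t ht
  exact (h.measureReal_pageSize_eq hβ hν₀ hν₁ n ht).symm

theorem tendsto_closedForm₂ {N : ℕ}
    (h : IsGeneralizedYuleModel μ β ν (saturatingRate lam N) gap X pick) (hβ : 0 < β)
    (hν₀ : 0 < ν) (hν₁ : ν ≤ 1) (hlam : 0 < lam) {n : ℕ} (hn : 1 ≤ n) (hnN : n ≤ N) :
    Tendsto (fun t : ℝ => μ.real {ω | pageSize gap X pick t ω = n}) atTop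
      (𝓝 (closedForm₂ N (lam / β ^ ν) n)) := by
  rw [closedForm₂_eq_stoppedChainMass (by positivity) hn hnN]
  simpa only [← saturatingRate_div] using
    h.tendsto_measureReal_pageSize hβ hν₀ hν₁ (saturatingRate_nonneg hlam.le N) hn

end IsGeneralizedYuleModel

end UniformPage

end YuleNetwork

theorem mainTheorem5 {Ω : Type*} [MeasurableSpace Ω] (μ : Measure Ω) [IsProbabilityMeasure μ]
    (β ν lam ρ : ℝ) (N : ℕ) (hβ : 0 < β) (hν₀ : 0 < ν) (hν₁ : ν ≤ 1) (hlam : 0 < lam)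
    (hN : 1 ≤ N) (hρ : ρ = lam / β ^ ν)
    (gap : ℕ → Ω → ℝ) (X : ℕ → ℝ≥0 → Ω → ℕ) (pick : ℝ → Ω → ℕ)
    (hmodel : YuleNetwork.IsGeneralizedYuleModel μ β ν (YuleNetwork.saturatingRate lam N)
      gap X pick) :
    -- the limiting probability mass function, in the form with positive Gamma arguments
    (∀ n : ℕ, 1 ≤ n → n ≤ N →
      Tendsto (fun t : ℝ => μ.real {ω | YuleNetwork.pageSize gap X pick t ω = n}) atTop
        (𝓝 (YuleNetwork.closedForm₂ N ρ n))) ∧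
    -- no mass is lost in the limit
    (∑ n ∈ Finset.Icc 1 N, YuleNetwork.closedForm₂ N ρ n = 1) ∧
    -- the first form of the mass function, when its Gamma factors are not at a pole
    ((∀ m : ℕ, 1 - (N : ℝ) / 2 - (1 / 2) * √((N : ℝ) ^ 2 + 4 / ρ) ≠ -(m : ℝ)) →
      ∀ n : ℕ, 1 ≤ n → n ≤ N →
        Tendsto (fun t : ℝ => μ.real {ω | YuleNetwork.pageSize gap X pick t ω = n}) atTop
          (𝓝 (YuleNetwork.closedForm₁ N ρ n))) ∧
    -- at the exceptional values of `ρ` the first form is understood by continuity in `ρ`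
    (∀ n : ℕ, 1 ≤ n → n ≤ N →
      Tendsto (fun r : ℝ => YuleNetwork.closedForm₁ N r n) (𝓝[≠] ρ)
        (𝓝 (YuleNetwork.closedForm₂ N ρ n))) ∧
    -- the special case `ρ = 1 / (N + 1)`
    (ρ = 1 / ((N : ℝ) + 1) → ∀ n : ℕ, 1 ≤ n → n ≤ N →
      YuleNetwork.closedForm₂ N ρ n = (1 + 1 / (N : ℝ)) * (1 / ((n : ℝ) ^ 2 + n)) ∧
      Tendsto (fun t : ℝ => μ.real {ω | YuleNetwork.pageSize gap X pick t ω = n}) atTop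
        (𝓝 ((1 + 1 / (N : ℝ)) * (1 / ((n : ℝ) ^ 2 + n))))) := by
  have hρ₀ : 0 < ρ := hρ ▸ by positivity
  have hlim : ∀ n : ℕ, 1 ≤ n → n ≤ N →
      Tendsto (fun t : ℝ => μ.real {ω | YuleNetwork.pageSize gap X pick t ω = n}) atTop
        (𝓝 (YuleNetwork.closedForm₂ N ρ n)) := fun n hn hnN =>
    hρ ▸ hmodel.tendsto_closedForm₂ hβ hν₀ hν₁ hlam hn hnN
  refine ⟨hlim, YuleNetwork.sum_closedForm₂ hρ₀ hN, fun hpole n hn hnN => ?_,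
    fun n hn hnN => YuleNetwork.tendsto_closedForm₁ hρ₀ hn hnN, fun hspecial n hn hnN => ?_⟩
  · rw [YuleNetwork.closedForm₁_eq_stoppedChainMass hρ₀ hn hnN hpole,
      ← YuleNetwork.closedForm₂_eq_stoppedChainMass hρ₀ hn hnN]
    exact hlim n hn hnN
  · have hq := hspecial ▸ YuleNetwork.closedForm₂_one_div_add_one hn hnN
    exact ⟨hq, hq ▸ hlim n hn hnN⟩
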